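/- Conventions. A lattice polytope in $\mathbb{R}^n$ is the convex hull of finitely many points of $\mathbb{Z}^n$; a (lattice) $d$-polytope is one whose affine span has dimension $d$. Two lattice polytopes $P\subset\mathbb{R}^n$ and $P'\subset\mathbb{R}^{n'}$ are integrally equivalent if some affine map $\operatorname{aff}P\to\operatorname{aff}P'$ maps $\mathbb{Z}^n\cap\operatorname{aff}P$ bijectively onto $\mathbb{Z}^{n'}\cap\operatorname{aff}P'$ and $P$ onto $P'$. For a vertex $u$ of $P$, let $T_uP=\operatorname{cone}(u'-u\mid u'\in P)$ be the tangent cone, inside the linear space $V$ parallel to $\operatorname{aff}P$; the normal cone of $P$ at $u$ is its dual $\{\varphi\in V^*\mid \varphi\ge 0\text{ on }T_uP\}$, and $V^*$ carries the lattice of all $\varphi$ taking integer values on $V\cap\mathbb{Z}^n$. A rational cone in $\mathbb{R}^m$ is a cone generated by finitely many vectors of $\mathbb{Z}^m$; it is a $d$-cone if its linear span has dimension $d$. Two cones $\sigma,\tau$ in real vector spaces with lattices are integrally equivalent if some linear isomorphism $\operatorname{span}\sigma\to\operatorname{span}\tau$ maps the lattice points of $\operatorname{span}\sigma$ onto those of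 $\operatorname{span}\tau$ and $\sigma$ onto $\tau$. Theorem. Let $N$ be a nonnegative integer. (1) Let $d$ be a nonnegative integer and let $\mathcal F$ be a finite family of rational $d$-cones. Then, up to integral equivalence, there are only finitely many lattice $d$-polytopes with exactly $N+1$ lattice points all of whose normal cones (at vertices) are integrally equivalent to cones in $\mathcal F$. (2) More generally, let $\mathcal F$ be a finite family of rational cones, of arbitrary dimensions. Then, up to integral equivalence, there are only finitely many lattice polytopes (of arbitrary dimension) with exactly $N+1$ lattice points all of whose normal cones are integrally equivalent to cones in $\mathcal F$. -/

import Mathlib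

namespace LatticePolytopes

/-- The lattice `ℤⁿ ⊂ ℝⁿ`. -/
def intLattice (n : ℕ) : Set (Fin n → ℝ) :=
  Set.range fun (z : Fin n → ℤ) (i : Fin n) => (z i : ℝ)

/-- A lattice polytope in `ℝⁿ`: the convex hull of finitely many points of `ℤⁿ`. -/
def IsLatticePolytope {n : ℕ} (P : Set (Fin n → ℝ)) : Prop :=
  ∃ S : Set (Fin n → ℝ), S.Finite ∧ S ⊆ intLattice n ∧ P = convexHull ℝ S

/-- The linear space parallel to the affine span of `P`. -/
abbrev dirSpace {n : ℕ} (P : Set (Fin n → ℝ)) : Submodule ℝ (Fin n → ℝ) :=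
  (affineSpan ℝ P).direction

/-- The dimension of a (nonempty) polytope, that is, of its affine span. -/
noncomputable def polytopeDim {n : ℕ} (P : Set (Fin n → ℝ)) : ℕ :=
  Module.finrank ℝ (dirSpace P)

/-- Integral equivalence of lattice polytopes `P ⊂ ℝⁿ` and `Q ⊂ ℝᵐ`: an affine map carries
`ℤⁿ ∩ aff P` bijectively onto `ℤᵐ ∩ aff Q`, and `P` onto `Q`. (An affine map defined on `aff P`
is the same as the restriction to `aff P` of an affine map defined on `ℝⁿ`.) -/
def IntegrallyEquivalent {n m : ℕ} (P : Set (Fin n → ℝ)) (Q : Set (Fin m → ℝ)) : Prop :=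
  ∃ f : (Fin n → ℝ) →ᵃ[ℝ] (Fin m → ℝ),
    Set.BijOn f (intLattice n ∩ affineSpan ℝ P) (intLattice m ∩ affineSpan ℝ Q) ∧ f '' P = Q

/-- A rational cone in `ℝᵐ`: generated by finitely many points of `ℤᵐ`. -/
def IsRationalCone {m : ℕ} (σ : PointedCone ℝ (Fin m → ℝ)) : Prop :=
  ∃ S : Set (Fin m → ℝ), S.Finite ∧ S ⊆ intLattice m ∧ σ = PointedCone.hull ℝ S

/-- The dimension of a cone, that is, of its linear span. -/
noncomputable def coneDim {V : Type*} [AddCommGroup V] [Module ℝ V] (σ : PointedCone ℝ V) : ℕ :=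
  Module.finrank ℝ (Submodule.span ℝ (σ : Set V))

/-- Integral equivalence of cones `σ ⊂ V` and `τ ⊂ W` with respect to lattices `Λ ⊂ V` and
`Γ ⊂ W`: a linear isomorphism of the linear spans carries `Λ ∩ span σ` onto `Γ ∩ span τ`,
and `σ` onto `τ`. -/
def ConesEquivalent {V W : Type*} [AddCommGroup V] [Module ℝ V] [AddCommGroup W] [Module ℝ W]
    (Λ : Set V) (σ : PointedCone ℝ V) (Γ : Set W) (τ : PointedCone ℝ W) : Prop :=
  ∃ f : Submodule.span ℝ (σ : Set V) ≃ₗ[ℝ] Submodule.span ℝ (τ : Set W),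
    (∀ x : Submodule.span ℝ (σ : Set V), (x : V) ∈ Λ ↔ (f x : W) ∈ Γ) ∧
    (∀ x : Submodule.span ℝ (σ : Set V), (x : V) ∈ σ ↔ (f x : W) ∈ τ)

/-- The tangent cone `cone (u' - u | u' ∈ P)` of `P` at a point `u` of `P`, as a cone in the
linear space parallel to `aff P`. -/
def tangentCone {n : ℕ} (P : Set (Fin n → ℝ)) (u : Fin n → ℝ) : PointedCone ℝ (dirSpace P) :=
  PointedCone.hull ℝ {x : dirSpace P | u + (x : Fin n → ℝ) ∈ P}

/-- The normal cone of `P` at `u`: the dual of the tangent cone. It lives in the dual of the linear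
space parallel to `aff P` (for full-dimensional `P` this is the dual of `ℝⁿ`). -/
def normalCone {n : ℕ} (P : Set (Fin n → ℝ)) (u : Fin n → ℝ) :
    PointedCone ℝ (Module.Dual ℝ (dirSpace P)) :=
  PointedCone.dual (Module.Dual.eval ℝ (dirSpace P)) (tangentCone P u : Set (dirSpace P))

/-- The lattice in which normal cones live: the dual of the lattice of integer vectors
parallel to `aff P`. -/
def dualLattice {n : ℕ} (P : Set (Fin n → ℝ)) : Set (Module.Dual ℝ (dirSpace P)) :=
  {φ | ∀ x : dirSpace P, (x : Fin n → ℝ) ∈ intLattice n → ∃ k : ℤ, φ x = k}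

/-- Every normal cone of `P` (at a vertex of `P`) is integrally equivalent to a member of `F`. -/
def NormalConesIn {n : ℕ} (F : Set (Σ m : ℕ, PointedCone ℝ (Fin m → ℝ)))
    (P : Set (Fin n → ℝ)) : Prop :=
  ∀ u ∈ P.extremePoints ℝ, ∃ σ ∈ F,
    ConesEquivalent (dualLattice P) (normalCone P u) (intLattice σ.1) σ.2

/-- The lattice polytopes, in `ℝⁿ` for any `n`, that have exactly `k` lattice points and all whose
normal cones are integrally equivalent to cones in `F`. -/
def polytopesWith (k : ℕ) (F : Set (Σ m : ℕ, PointedCone ℝ (Fin m → ℝ))) :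
    Set (Σ n : ℕ, Set (Fin n → ℝ)) :=
  {P | IsLatticePolytope P.2 ∧ (P.2 ∩ intLattice P.1).encard = k ∧ NormalConesIn F P.2}

/-- The class `C` of polytopes contains only finitely many members up to integral equivalence. -/
def FinitelyManyUpToEquivalence (C : Set (Σ n : ℕ, Set (Fin n → ℝ))) : Prop :=
  ∃ T ⊆ C, T.Finite ∧ ∀ P ∈ C, ∃ Q ∈ T, IntegrallyEquivalent P.2 Q.2

end LatticePolytopes

/-!
The vertices and edges of a polytope form a connected graph: a linear functional that separates a
connected component from the remaining vertices would have no ascending edge at its maximum over the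
component. So every vertex is joined to a chosen one by fewer than `K` edges, `K` being the number
of lattice points, and it is enough to bound the edge vectors at a vertex in terms of those at a
neighbouring vertex.

A normal cone determines the tangent cone up to a lattice isomorphism. A ray of the tangent cone
carries only finitely many candidates for the edge vector, because a long edge would contain more
than `K` lattice points. Hence, up to lattice isomorphism, the edge vectors at every vertex lie in a
finite set that depends only on `F`, on `K` and on the dimension. At one vertex the isomorphism is
used to fix coordinates, and the problem is to bound it at the neighbours.

Let `[u, u']` be an edge. Modulo `u' - u` the tangent cones at `u` and `u'` agree, so every extreme
ray of the quotient cone comes from an edge `[u, w]` and from an edge `[u', w']`, with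
`w' - u' = a (w - u) + b (u' - u)` and `a > 0`. Integrality bounds `a` from above, and the number of
lattice points then bounds `b`. The resulting edge vectors at `u'`, together with `u - u'`, span, so
an isomorphism that maps them into a fixed finite set is one of finitely many linear maps.
-/

namespace LatticePolytopes

open scoped Topology

section Cones

variable {V W : Type*} [AddCommGroup V] [Module ℝ V] [AddCommGroup W] [Module ℝ W]

/-- `v` spans an extreme ray of the cone `C`, that is, a one-dimensional face. -/
def IsExtremeVec (C : PointedCone ℝ V) (v : V) : Prop :=
  v ≠ 0 ∧ (PointedCone.hull ℝ {v}).IsFaceOf C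

lemma mem_hull_singleton {v x : V} :
    x ∈ PointedCone.hull ℝ {v} ↔ ∃ a : ℝ, 0 ≤ a ∧ a • v = x :=
  Submodule.mem_span_singleton.trans
    ⟨fun ⟨a, ha⟩ => ⟨a, a.2, ha⟩, fun ⟨a, ha, h⟩ => ⟨⟨a, ha⟩, h⟩⟩

lemma mem_hull_insert {R : Set V} {v x : V} :
    x ∈ PointedCone.hull ℝ (insert v R) ↔
      ∃ a : ℝ, 0 ≤ a ∧ ∃ p ∈ PointedCone.hull ℝ R, x = a • v + p :=
  Submodule.mem_span_insert.trans
    ⟨fun ⟨a, p, hp, h⟩ => ⟨a, a.2, p, hp, h⟩, fun ⟨a, ha, p, hp, h⟩ => ⟨⟨a, ha⟩, p, hp, h⟩⟩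

lemma eq_zero_of_add_eq_zero {C : PointedCone ℝ V} (hC : C.toConvexCone.Salient) {x y : V}
    (hx : x ∈ C) (hy : y ∈ C) (hxy : x + y = 0) : x = 0 := by
  by_contra h
  exact hC x hx h (by rwa [neg_eq_of_add_eq_zero_right hxy])

lemma IsExtremeVec.mem {C : PointedCone ℝ V} {v : V} (hv : IsExtremeVec C v) : v ∈ C :=
  hv.2.le (PointedCone.subset_hull rfl)

lemma IsExtremeVec.smul {C : PointedCone ℝ V} {v : V} (hv : IsExtremeVec C v) {a : ℝ}
    (ha : 0 < a) : IsExtremeVec C (a • v) := by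
  refine ⟨smul_ne_zero ha.ne' hv.1, ?_⟩
  convert hv.2 using 1
  refine le_antisymm (Submodule.span_le.2 ?_) (Submodule.span_le.2 ?_) <;>
    rw [Set.singleton_subset_iff, SetLike.mem_coe, mem_hull_singleton]
  · exact ⟨a, ha.le, rfl⟩
  · exact ⟨a⁻¹, inv_nonneg.2 ha.le, inv_smul_smul₀ ha.ne' v⟩

lemma isExtremeVec_map_iff {C : PointedCone ℝ V} {v : V} {f : V →ₗ[ℝ] W}
    (hf : Function.Injective f) : IsExtremeVec (C.map f) (f v) ↔ IsExtremeVec C v := by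
  rw [IsExtremeVec, IsExtremeVec, map_ne_zero_iff f hf, ← PointedCone.isFaceOf_map_iff hf]
  simp only [PointedCone.map, PointedCone.hull, Submodule.map_span, Set.image_singleton]
  rfl

lemma mem_hull_of_not_isExtremeVec {R : Set V} {v : V}
    (hC : (PointedCone.hull ℝ (insert v R)).toConvexCone.Salient)
    (hv : ¬ IsExtremeVec (PointedCone.hull ℝ (insert v R)) v) : v ∈ PointedCone.hull ℝ R := by
  by_cases hv0 : v = 0
  · exact hv0 ▸ Submodule.zero_mem _
  have hvC : v ∈ PointedCone.hull ℝ (insert v R) := PointedCone.subset_hull (Set.mem_insert v R)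
  have hRC : PointedCone.hull ℝ R ≤ PointedCone.hull ℝ (insert v R) :=
    Submodule.span_mono (Set.subset_insert v R)
  contrapose! hv
  refine ⟨hv0, Submodule.span_mono (by simp), fun {x y a} hx hy ha hxy => ?_⟩
  obtain ⟨b, hb, p, hp, rfl⟩ := mem_hull_insert.1 hx
  obtain ⟨c, -, q, hq, rfl⟩ := mem_hull_insert.1 hy
  obtain ⟨e, -, hxy⟩ := mem_hull_singleton.1 hxy
  -- Either `v` is a combination of `R`, or two vectors of the cone add up to `0`.
  have hrest : a • p + q = (e - (a * b + c)) • v := by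
    linear_combination (norm := module) -hxy
  have hap : a • p ∈ PointedCone.hull ℝ R := PointedCone.smul_mem _ ha.le hp
  have hle : e - (a * b + c) ≤ 0 := by
    by_contra! hpos
    exact hv ((PointedCone.smul_mem_iff _ hpos).1 (hrest ▸ Submodule.add_mem _ hap hq))
  have hp0 : a • p = 0 :=
    eq_zero_of_add_eq_zero hC (hRC hap)
      (Submodule.add_mem _ (hRC hq) (PointedCone.smul_mem _ (neg_nonneg.2 hle) hvC))
      (by linear_combination (norm := module) hrest)
  rw [(smul_eq_zero.1 hp0).resolve_left ha.ne', add_zero]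
  exact mem_hull_singleton.2 ⟨b, hb, rfl⟩

lemma hull_isExtremeVec_of_fg {C : PointedCone ℝ V} (hC : C.toConvexCone.Salient) (hfg : C.FG) :
    PointedCone.hull ℝ {v | IsExtremeVec C v} = C := by
  classical
  obtain ⟨S, hS⟩ := exists_minimal_of_wellFoundedLT
    (fun S : Finset V => PointedCone.hull ℝ (S : Set V) = C) hfg
  refine le_antisymm (Submodule.span_le.2 fun v hv => hv.mem) ?_
  nth_rewrite 1 [← hS.prop]
  refine Submodule.span_mono fun v hvS => ?_
  have hinsert : insert v ((S.erase v : Finset V) : Set V) = S := by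
    rw [← Finset.coe_insert, Finset.insert_erase hvS]
  by_contra hv
  have hred : v ∈ PointedCone.hull ℝ ((S.erase v : Finset V) : Set V) := by
    apply mem_hull_of_not_isExtremeVec <;> rwa [hinsert, hS.prop]
  refine hS.not_prop_of_lt (Finset.erase_ssubset hvS) ?_
  rw [← hS.prop, ← hinsert]
  exact (Submodule.span_insert_eq_span hred).symm

lemma mem_hull_inter_of_isFaceOf {S : Set V} {F : PointedCone ℝ V}
    (hF : F.IsFaceOf (PointedCone.hull ℝ S)) {x : V} (hx : x ∈ F) :
    x ∈ PointedCone.hull ℝ (S ∩ F) := by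
  have hxS := hF.le hx
  induction hxS using Submodule.span_induction with
  | mem x hxS => exact PointedCone.subset_hull ⟨hxS, hx⟩
  | zero => exact Submodule.zero_mem _
  | add x y hxS hyS ihx ihy =>
    exact Submodule.add_mem _ (ihx (hF.mem_of_add_mem_left hxS hyS hx))
      (ihy (hF.mem_of_add_mem_right hxS hyS hx))
  | smul a x _ ih =>
    obtain rfl | ha := eq_zero_or_pos a
    · rw [zero_smul]
      exact Submodule.zero_mem _
    · exact Submodule.smul_mem _ a (ih ((PointedCone.smul_mem_iff F ha).1 hx))

lemma IsExtremeVec.exists_generator {S : Set V} {v : V}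
    (hv : IsExtremeVec (PointedCone.hull ℝ S) v) : ∃ s ∈ S, ∃ a : ℝ, 0 < a ∧ s = a • v := by
  have hmem := mem_hull_inter_of_isFaceOf hv.2 (PointedCone.subset_hull rfl)
  obtain ⟨s, hs, hs0⟩ : ∃ s ∈ S ∩ PointedCone.hull ℝ {v}, s ≠ 0 := by
    by_contra! h
    rw [PointedCone.hull, Submodule.span_eq_bot.2 h] at hmem
    exact hv.1 hmem
  obtain ⟨a, ha, rfl⟩ := mem_hull_singleton.1 hs.2
  exact ⟨_, hs.1, a, ha.lt_of_ne' (by rintro rfl; simp at hs0), rfl⟩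

end Cones

section DirCone

variable {V W : Type*} [AddCommGroup V] [Module ℝ V] [AddCommGroup W] [Module ℝ W]

/-- The cone of directions from `u` into `P`: the tangent cone, regarded in the ambient space. -/
def dirCone (P : Set V) (u : V) : PointedCone ℝ V :=
  PointedCone.hull ℝ {x | u + x ∈ P}

lemma sub_mem_dirCone {P : Set V} {u p : V} (hp : p ∈ P) : p - u ∈ dirCone P u :=
  PointedCone.subset_hull (by simpa)

lemma eventually_add_smul_mem {P : Set V} (hP : Convex ℝ P) {u : V} (hu : u ∈ P) {x : V} {ε : ℝ}
    (hε : 0 < ε) (hx : u + ε • x ∈ P) : ∀ᶠ t in 𝓝[>] (0 : ℝ), u + t • x ∈ P := by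
  filter_upwards [Ioo_mem_nhdsGT hε] with t ht
  have h := hP.add_smul_mem hu hx (t := t / ε) ⟨(div_pos ht.1 hε).le, (div_le_one hε).2 ht.2.le⟩
  rwa [smul_smul, div_mul_cancel₀ t hε.ne'] at h

lemma mem_dirCone_iff_exists {P : Set V} (hP : Convex ℝ P) {u : V} (hu : u ∈ P) {x : V} :
    x ∈ dirCone P u ↔ ∃ ε : ℝ, 0 < ε ∧ u + ε • x ∈ P := by
  refine ⟨fun hx => ?_, fun ⟨ε, hε, h⟩ =>
    (PointedCone.smul_mem_iff _ hε).1 (PointedCone.subset_hull h)⟩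
  induction hx using Submodule.span_induction with
  | mem x hx => exact ⟨1, one_pos, by simpa using hx⟩
  | zero => exact ⟨1, one_pos, by simpa⟩
  | add x y _ _ hx hy =>
    obtain ⟨ε, hε, hx⟩ := hx
    obtain ⟨δ, hδ, hy⟩ := hy
    obtain ⟨t, ⟨hxt, hyt⟩, ht⟩ := (((eventually_add_smul_mem hP hu hε hx).and
      (eventually_add_smul_mem hP hu hδ hy)).and self_mem_nhdsWithin).exists
    refine ⟨t / 2, half_pos ht, ?_⟩
    convert hP.midpoint_mem hxt hyt using 1
    rw [midpoint_eq_smul_add, invOf_eq_inv]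
    module
  | smul a x _ hx =>
    obtain ⟨ε, hε, hx⟩ := hx
    obtain rfl | ha := eq_zero_or_pos a
    · exact ⟨1, one_pos, by simpa⟩
    · have ha' : (0 : ℝ) < a := ha
      refine ⟨ε / a, div_pos hε ha', ?_⟩
      rw [show a • x = (a : ℝ) • x from rfl, smul_smul, div_mul_cancel₀ ε ha'.ne']
      exact hx

lemma eventually_add_smul_mem_of_mem_dirCone {P : Set V} (hP : Convex ℝ P) {u : V} (hu : u ∈ P)
    {x : V} (hx : x ∈ dirCone P u) : ∀ᶠ t in 𝓝[>] (0 : ℝ), u + t • x ∈ P := by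
  obtain ⟨ε, hε, h⟩ := (mem_dirCone_iff_exists hP hu).1 hx
  exact eventually_add_smul_mem hP hu hε h

lemma salient_dirCone {P : Set V} (hP : Convex ℝ P) {u : V} (hu : u ∈ P.extremePoints ℝ) :
    (dirCone P u).toConvexCone.Salient := by
  intro x hx hx0 hx'
  obtain ⟨t, ⟨hxt, hxt'⟩, ht⟩ := (((eventually_add_smul_mem_of_mem_dirCone hP hu.1 hx).and
    (eventually_add_smul_mem_of_mem_dirCone hP hu.1 hx')).and self_mem_nhdsWithin).exists
  have hmid : u ∈ openSegment ℝ (u + t • x) (u + t • -x) :=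
    ⟨1 / 2, 1 / 2, by norm_num, by norm_num, by norm_num, by module⟩
  have h := ((mem_extremePoints.1 hu).2 _ hxt _ hxt' hmid).1
  exact smul_ne_zero (ne_of_gt ht) hx0 (by simpa using h)

lemma map_dirCone (f : V →ₗ[ℝ] W) (P : Set V) (u : V) :
    (dirCone P u).map f = dirCone (f '' P) (f u) := by
  rw [dirCone, PointedCone.map, Submodule.map_span, dirCone]
  congr 1
  ext y
  constructor
  · rintro ⟨x, hx, rfl⟩
    exact ⟨u + x, hx, map_add f u x⟩
  · rintro ⟨p, hp, hpy⟩
    refine ⟨p - u, by simpa, ?_⟩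
    simp [hpy]

lemma dirCone_convexHull (S : Set V) (u : V) :
    dirCone (convexHull ℝ S) u = PointedCone.hull ℝ {x | u + x ∈ S} := by
  refine le_antisymm (Submodule.span_le.2 fun x hx => ?_)
    (Submodule.span_mono fun x hx => subset_convexHull ℝ S hx)
  have hconv : Convex ℝ ((· - u) ⁻¹' (PointedCone.hull ℝ {x | u + x ∈ S} : Set V)) := by
    simpa only [sub_eq_add_neg] using (PointedCone.convex _).translate_preimage_left (-u)
  have hsub : convexHull ℝ S ⊆ (· - u) ⁻¹' (PointedCone.hull ℝ {x | u + x ∈ S} : Set V) :=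
    convexHull_min (fun s hs => PointedCone.subset_hull (by simpa)) hconv
  simpa using hsub hx

end DirCone

section Polytope

variable {V : Type*} [AddCommGroup V] [Module ℝ V]

/-- A polytope: a set with finitely many extreme points (its vertices), of which it is the convex
hull. -/
structure IsPolytope (P : Set V) : Prop where
  finite_extremePoints : (P.extremePoints ℝ).Finite
  convexHull_extremePoints : convexHull ℝ (P.extremePoints ℝ) = P

/-- `u` and `w` are the end points of an edge of `P`. -/
def IsEdge (P : Set V) (u w : V) : Prop :=
  u ≠ w ∧ IsExtreme ℝ P (segment ℝ u w)

lemma IsPolytope.convex {P : Set V} (hP : IsPolytope P) : Convex ℝ P :=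
  hP.convexHull_extremePoints ▸ convex_convexHull ℝ _

lemma IsPolytope.extremePoints_nonempty {P : Set V} (hP : IsPolytope P) (hne : P.Nonempty) :
    (P.extremePoints ℝ).Nonempty := by
  rwa [← hP.convexHull_extremePoints, convexHull_nonempty_iff] at hne

lemma IsPolytope.dirCone_eq {P : Set V} (hP : IsPolytope P) (u : V) :
    dirCone P u = PointedCone.hull ℝ {x | u + x ∈ P.extremePoints ℝ} := by
  rw [← dirCone_convexHull, hP.convexHull_extremePoints]

lemma IsPolytope.fg_dirCone {P : Set V} (hP : IsPolytope P) (u : V) : (dirCone P u).FG := by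
  rw [hP.dirCone_eq]
  exact Submodule.fg_span (hP.finite_extremePoints.preimage (add_right_injective u).injOn)

lemma isPolytope_convexHull {V : Type*} [NormedAddCommGroup V] [NormedSpace ℝ V] {S : Set V}
    (hS : S.Finite) : IsPolytope (convexHull ℝ S) := by
  have hfin : ((convexHull ℝ S).extremePoints ℝ).Finite := hS.subset extremePoints_convexHull_subset
  refine ⟨hfin, ?_⟩
  rw [← (hfin.isCompact_convexHull ℝ).isClosed.closure_eq]
  exact closure_convexHull_extremePoints (hS.isCompact_convexHull ℝ) (convex_convexHull ℝ S)

lemma IsEdge.symm {P : Set V} {u w : V} (h : IsEdge P u w) : IsEdge P w u :=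
  ⟨h.1.symm, segment_symm ℝ u w ▸ h.2⟩

lemma left_mem_extremePoints_segment (u w : V) : u ∈ (segment ℝ u w).extremePoints ℝ := by
  refine mem_extremePoints_iff_left.2 ⟨left_mem_segment ℝ u w, ?_⟩
  rw [segment_eq_image']
  rintro _ ⟨s, hs, rfl⟩ _ ⟨t, ht, rfl⟩ ⟨a, b, ha, hb, hab, h⟩
  have hzero : (a * s + b * t) • (w - u) = 0 := by
    rw [← sub_self u]
    nth_rewrite 2 [← h]
    obtain rfl := eq_sub_of_add_eq hab
    module
  rcases smul_eq_zero.1 hzero with h0 | h0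
  · have hs0 : s = 0 := by
      have := mul_nonneg ha.le hs.1
      have := mul_nonneg hb.le ht.1
      exact (mul_eq_zero.1 (by linarith : a * s = 0)).resolve_left ha.ne'
    simp [hs0]
  · simp [h0]

lemma IsEdge.left_mem {P : Set V} {u w : V} (h : IsEdge P u w) : u ∈ P.extremePoints ℝ :=
  h.2.extremePoints_subset_extremePoints (left_mem_extremePoints_segment u w)

lemma IsEdge.right_mem {P : Set V} {u w : V} (h : IsEdge P u w) : w ∈ P.extremePoints ℝ :=
  h.symm.left_mem

lemma IsEdge.isExtremeVec {P : Set V} (hP : Convex ℝ P) {u w : V} (h : IsEdge P u w) :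
    IsExtremeVec (dirCone P u) (w - u) := by
  refine ⟨sub_ne_zero.2 h.1.symm, ?_, fun {x y a} hx hy ha hxy => ?_⟩
  · exact Submodule.span_le.2 (Set.singleton_subset_iff.2 (sub_mem_dirCone h.right_mem.1))
  obtain ⟨c, hc, hxy⟩ := mem_hull_singleton.1 hxy
  have hu : u ∈ P := h.left_mem.1
  obtain ⟨t, ⟨hxt, hyt⟩, ht, htc⟩ := ((eventually_add_smul_mem_of_mem_dirCone hP hu
    (PointedCone.smul_mem _ ha.le hx)).and (eventually_add_smul_mem_of_mem_dirCone hP hu hy)).and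
      (Ioo_mem_nhdsGT (by positivity : 0 < (c + 1)⁻¹)) |>.exists
  have htc' : t / 2 * c ≤ 1 := by
    rw [← one_div, lt_div_iff₀ (by positivity)] at htc
    linarith
  have hmem : u + (t / 2 * c) • (w - u) ∈ segment ℝ u w := by
    rw [segment_eq_image']
    exact ⟨_, ⟨by positivity, htc'⟩, rfl⟩
  have hopen : u + (t / 2 * c) • (w - u) ∈ openSegment ℝ (u + t • a • x) (u + t • y) := by
    refine ⟨1 / 2, 1 / 2, by norm_num, by norm_num, by norm_num, ?_⟩
    rw [mul_smul, hxy]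
    module
  have hseg := h.2.left_mem_of_mem_openSegment hxt hyt hmem hopen
  rw [segment_eq_image'] at hseg
  obtain ⟨s, hs, hsx⟩ := hseg
  refine mem_hull_singleton.2 ⟨(t * a)⁻¹ * s, mul_nonneg (by positivity) hs.1, ?_⟩
  rw [mul_smul, add_left_cancel hsx, smul_smul t a, inv_smul_smul₀ (by positivity)]

lemma isEdge_of_isExtremeVec {P : Set V} (hP : Convex ℝ P) {u w : V} (hu : u ∈ P)
    (hw : w ∈ P.extremePoints ℝ) (h : IsExtremeVec (dirCone P u) (w - u)) : IsEdge P u w := by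
  refine ⟨(sub_ne_zero.1 h.1).symm, hP.segment_subset hu hw.1, ?_⟩
  rintro x hx y hy z hz ⟨a, b, ha, hb, hab, rfl⟩
  rw [segment_eq_image'] at hz ⊢
  obtain ⟨t, ht, hz⟩ := hz
  have hray : x - u ∈ PointedCone.hull ℝ {w - u} := by
    refine h.2.mem_of_smul_add_smul_mem_left (sub_mem_dirCone hx) (sub_mem_dirCone hy) ha hb ?_
    refine mem_hull_singleton.2 ⟨t, ht.1, ?_⟩
    obtain rfl := eq_sub_of_add_eq hab
    linear_combination (norm := module) hz
  obtain ⟨s, hs, hsx⟩ := mem_hull_singleton.1 hray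
  refine ⟨s, ⟨hs, ?_⟩, by simp [hsx]⟩
  by_contra! hs1
  have hopen : w ∈ openSegment ℝ u x := by
    have hs0 : 0 < s := by linarith
    refine ⟨1 - s⁻¹, s⁻¹, sub_pos.2 (inv_lt_one_of_one_lt₀ hs1), by positivity, by ring, ?_⟩
    rw [← sub_add_cancel x u, ← hsx, smul_add, inv_smul_smul₀ hs0.ne']
    module
  exact h.1 (by rw [((mem_extremePoints.1 hw).2 _ hu _ hx hopen).1, sub_self])

lemma IsPolytope.exists_isEdge {P : Set V} (hP : IsPolytope P) {u v : V} (hu : u ∈ P)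
    (hv : IsExtremeVec (dirCone P u) v) : ∃ w, IsEdge P u w ∧ ∃ a : ℝ, 0 < a ∧ w - u = a • v := by
  have hv' := hv
  rw [hP.dirCone_eq] at hv'
  obtain ⟨s, hs, a, ha, rfl⟩ := hv'.exists_generator
  refine ⟨u + a • v, isEdge_of_isExtremeVec hP.convex hu hs ?_, a, ha, add_sub_cancel_left _ _⟩
  rw [add_sub_cancel_left]
  exact hv.smul ha

lemma IsPolytope.dirCone_eq_hull_edges {P : Set V} (hP : IsPolytope P) {u : V}
    (hu : u ∈ P.extremePoints ℝ) : dirCone P u = PointedCone.hull ℝ {x | IsEdge P u (u + x)} := by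
  refine le_antisymm ?_ (Submodule.span_mono fun x hx => (IsEdge.right_mem hx).1)
  rw [← hull_isExtremeVec_of_fg (salient_dirCone hP.convex hu) (hP.fg_dirCone u)]
  refine Submodule.span_le.2 fun v hv => ?_
  obtain ⟨w, hw, a, ha, hwv⟩ := hP.exists_isEdge hu.1 hv
  rw [SetLike.mem_coe, ← PointedCone.smul_mem_iff _ ha, ← hwv]
  exact PointedCone.subset_hull (by simpa using hw)

end Polytope

section ParallelEdges

variable {V W : Type*} [AddCommGroup V] [Module ℝ V] [AddCommGroup W] [Module ℝ W]

lemma IsExtremeVec.exists_generator_of_map {S : Set V} {f : V →ₗ[ℝ] W} {y : W}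
    (hy : IsExtremeVec ((PointedCone.hull ℝ S).map f) y) :
    ∃ s ∈ S, ∃ a : ℝ, 0 < a ∧ f s = a • y := by
  rw [PointedCone.map, Submodule.map_span] at hy
  obtain ⟨_, ⟨s, hs, rfl⟩, h⟩ := hy.exists_generator
  exact ⟨s, hs, h⟩

lemma mem_extremePoints_image_of_isExtreme_fiber {P : Set V} (hP : Convex ℝ P) {f : V →ₗ[ℝ] W}
    {u : V} (hu : u ∈ P) (h : IsExtreme ℝ P {p ∈ P | f p = f u}) :
    f u ∈ (f '' P).extremePoints ℝ := by
  refine mem_extremePoints_iff_left.2 ⟨⟨u, hu, rfl⟩, ?_⟩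
  rintro _ ⟨x, hx, rfl⟩ _ ⟨y, hy, rfl⟩ ⟨a, b, ha, hb, hab, hxy⟩
  have hz : a • x + b • y ∈ {p ∈ P | f p = f u} :=
    ⟨hP hx hy ha.le hb.le hab, by rw [map_add, map_smul, map_smul, hxy]⟩
  exact (h.left_mem_of_mem_openSegment hx hy hz ⟨a, b, ha, hb, hab, rfl⟩).2

lemma IsEdge.nonneg_of_add_smul_mem {P : Set V} (hP : Convex ℝ P) {u u' : V} (h : IsEdge P u u')
    {a : ℝ} (ha : u + a • (u' - u) ∈ P) : 0 ≤ a := by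
  by_contra! hneg
  have hmem : a • (u' - u) ∈ dirCone P u := PointedCone.subset_hull ha
  have hmem' : (-a) • (u' - u) ∈ dirCone P u :=
    PointedCone.smul_mem _ (neg_pos.2 hneg).le (sub_mem_dirCone h.right_mem.1)
  exact smul_ne_zero hneg.ne (sub_ne_zero.2 h.1.symm)
    (eq_zero_of_add_eq_zero (salient_dirCone hP h.left_mem) hmem hmem' (by module))

lemma IsEdge.fiber_mkQ {P : Set V} (hP : Convex ℝ P) {u u' : V} (h : IsEdge P u u') :
    {p ∈ P | (ℝ ∙ (u' - u)).mkQ p = (ℝ ∙ (u' - u)).mkQ u} = segment ℝ u u' := by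
  ext p
  rw [segment_eq_image']
  simp only [Set.mem_ofPred_eq, Submodule.mkQ_apply, Submodule.Quotient.eq,
    Submodule.mem_span_singleton]
  constructor
  · rintro ⟨hp, a, ha⟩
    have hp' : p = u + a • (u' - u) := by rw [ha]; abel
    have ha0 := h.nonneg_of_add_smul_mem hP (hp' ▸ hp)
    have ha1 := h.symm.nonneg_of_add_smul_mem hP (a := 1 - a) (by convert hp; rw [hp']; module)
    exact ⟨a, ⟨ha0, by linarith⟩, hp'.symm⟩
  · rintro ⟨a, ha, rfl⟩
    refine ⟨h.2.subset ?_, a, by simp⟩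
    rw [segment_eq_image']
    exact ⟨a, ha, rfl⟩

lemma IsEdge.salient_map_mkQ_dirCone {P : Set V} (hP : Convex ℝ P) {u u' : V}
    (h : IsEdge P u u') :
    ((dirCone P u).map (ℝ ∙ (u' - u)).mkQ).toConvexCone.Salient := by
  rw [map_dirCone]
  refine salient_dirCone (hP.linear_image _)
    (mem_extremePoints_image_of_isExtreme_fiber hP h.left_mem.1 ?_)
  rw [h.fiber_mkQ hP]
  exact h.2

/-- Modulo the direction of the edge `[u, u']` of `P`, the edge `[u', w']` points in the same
direction as the edge `[u, w]`, and neither is parallel to `[u, u']`. -/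
structure AreParallelEdges (P : Set V) (u u' w w' : V) : Prop where
  left : IsEdge P u w
  right : IsEdge P u' w'
  notMem_span : w - u ∉ ℝ ∙ (u' - u)
  exists_eq : ∃ a b : ℝ, 0 < a ∧ w' - u' = a • (w - u) + b • (u' - u)

lemma IsEdge.exists_areParallelEdges {P : Set V} (hP : IsPolytope P) {u u' : V}
    (h : IsEdge P u u') {y : V ⧸ (ℝ ∙ (u' - u))}
    (hy : IsExtremeVec ((dirCone P u).map (ℝ ∙ (u' - u)).mkQ) y) :
    ∃ w w', AreParallelEdges P u u' w w' ∧
      ∃ a : ℝ, 0 < a ∧ (ℝ ∙ (u' - u)).mkQ (w' - u') = a • y := by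
  have hy' := hy
  have hqu : (ℝ ∙ (u' - u)).mkQ u = (ℝ ∙ (u' - u)).mkQ u' :=
    ((Submodule.Quotient.eq _).2 (Submodule.mem_span_singleton_self _)).symm
  rw [map_dirCone, hqu, ← map_dirCone, hP.dirCone_eq_hull_edges h.right_mem] at hy'
  rw [hP.dirCone_eq_hull_edges h.left_mem] at hy
  obtain ⟨x, hx, a, ha, hxy⟩ := hy.exists_generator_of_map
  obtain ⟨x', hx', a', ha', hxy'⟩ := hy'.exists_generator_of_map
  have hpar : x' - (a' / a) • x ∈ ℝ ∙ (u' - u) := by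
    rw [← Submodule.Quotient.mk_eq_zero, ← Submodule.mkQ_apply, map_sub, map_smul, hxy, hxy',
      smul_smul, div_mul_cancel₀ _ ha.ne', sub_self]
  obtain ⟨b, hb⟩ := Submodule.mem_span_singleton.1 hpar
  refine ⟨u + x, u' + x', ⟨hx, hx', fun hmem => ?_, a' / a, b, div_pos ha' ha, ?_⟩, a', ha', ?_⟩
  · rw [add_sub_cancel_left, ← Submodule.Quotient.mk_eq_zero, ← Submodule.mkQ_apply, hxy] at hmem
    exact smul_ne_zero ha.ne' hy.1 hmem
  · rw [hb]
    module
  · rwa [add_sub_cancel_left]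

lemma IsEdge.vectorSpan_le {P : Set V} (hP : IsPolytope P) {u u' : V} (h : IsEdge P u u') :
    vectorSpan ℝ P ≤ Submodule.span ℝ
      (insert (u - u') {x | ∃ w w', AreParallelEdges P u u' w w' ∧ w' - u' = x}) := by
  set L := Submodule.span ℝ
    (insert (u - u') {x | ∃ w w', AreParallelEdges P u u' w w' ∧ w' - u' = x})
  set q := (ℝ ∙ (u' - u)).mkQ
  have hcone : (dirCone P u).map q ≤ PointedCone.ofSubmodule (L.map q) := by
    rw [← hull_isExtremeVec_of_fg (h.salient_map_mkQ_dirCone hP.convex)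
      (Submodule.FG.map _ (hP.fg_dirCone u))]
    refine Submodule.span_le.2 fun y hy => ?_
    obtain ⟨w, w', hww, a, ha, hwy⟩ := h.exists_areParallelEdges hP hy
    have hmem : a • y ∈ L.map q :=
      hwy ▸ Submodule.mem_map_of_mem (Submodule.subset_span (Or.inr ⟨w, w', hww, rfl⟩))
    exact (Submodule.smul_mem_iff (L.map q) ha.ne').1 hmem
  have hker : ℝ ∙ (u' - u) ≤ L := by
    rw [Submodule.span_singleton_le_iff_mem, ← neg_sub]
    exact Submodule.neg_mem _ (Submodule.subset_span (Set.mem_insert _ _))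
  rw [vectorSpan_eq_span_vsub_set_right ℝ h.left_mem.1, Submodule.span_le]
  rintro _ ⟨p, hp, rfl⟩
  have hmem : p - u ∈ (L.map q).comap q :=
    hcone (PointedCone.mem_map.2 ⟨p - u, sub_mem_dirCone hp, rfl⟩)
  rwa [Submodule.comap_map_mkQ, sup_eq_right.2 hker] at hmem

end ParallelEdges

section EdgeGraph

variable {V : Type*} [NormedAddCommGroup V] [NormedSpace ℝ V]

/-- The graph of vertices and edges of `P`. -/
def edgeGraph (P : Set V) : SimpleGraph (P.extremePoints ℝ) where
  Adj u w := IsEdge P u w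
  symm := ⟨fun _ _ h => h.symm⟩
  loopless := ⟨fun _ h => h.1 rfl⟩

lemma IsPolytope.extremePoints_subset_of_isEdge_mem {P : Set V} (hP : IsPolytope P) {R : Set V}
    (hRP : R ⊆ P.extremePoints ℝ) (hne : R.Nonempty)
    (hR : ∀ x ∈ R, ∀ w, IsEdge P x w → w ∈ R) : P.extremePoints ℝ ⊆ R := by
  intro w hw
  have hfin : R.Finite := hP.finite_extremePoints.subset hRP
  suffices hwR : w ∈ convexHull ℝ R by
    have hsub : convexHull ℝ R ⊆ P := convexHull_min (fun x hx => (hRP hx).1) hP.convex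
    exact extremePoints_convexHull_subset
      (inter_extremePoints_subset_extremePoints_of_subset hsub ⟨hwR, hw⟩)
  by_contra hwR
  obtain ⟨c, a, hca, haw⟩ := geometric_hahn_banach_closed_point (convex_convexHull ℝ R)
    (hfin.isCompact_convexHull ℝ).isClosed hwR
  -- A member of `R` that maximizes `c` over its neighbours maximizes `c` over `P`.
  obtain ⟨x, hxR, hx⟩ := Set.exists_max_image R c hfin hne
  have hcone : dirCone P x ≤ (PointedCone.positive ℝ ℝ).comap (-c : V →ₗ[ℝ] ℝ) := by
    rw [hP.dirCone_eq_hull_edges (hRP hxR)]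
    refine Submodule.span_le.2 fun y hy => ?_
    have hle := hx (x + y) (hR x hxR _ hy)
    rw [map_add] at hle
    simpa using hle
  have hcw : 0 ≤ -c (w - x) := hcone (sub_mem_dirCone hw.1)
  rw [map_sub] at hcw
  linarith [hca x (subset_convexHull ℝ R hxR)]

lemma IsPolytope.preconnected_edgeGraph {P : Set V} (hP : IsPolytope P) :
    (edgeGraph P).Preconnected := by
  intro u w
  have hsub := hP.extremePoints_subset_of_isEdge_mem
    (R := (↑) '' {x : P.extremePoints ℝ | (edgeGraph P).Reachable u x})
    (Subtype.coe_image_subset _ _) ⟨u, u, SimpleGraph.Reachable.refl u, rfl⟩ ?_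
  · obtain ⟨x, hx, hxw⟩ := hsub w.2
    exact Subtype.ext hxw ▸ hx
  · rintro _ ⟨x, hx, rfl⟩ y hy
    have hadj : (edgeGraph P).Adj x ⟨y, hy.right_mem⟩ := hy
    exact ⟨⟨y, hy.right_mem⟩, SimpleGraph.Reachable.trans hx hadj.reachable, rfl⟩

lemma IsPolytope.exists_walk_length_lt {P : Set V} (hP : IsPolytope P) (u w : P.extremePoints ℝ) :
    ∃ p : (edgeGraph P).Walk u w, p.length < (P.extremePoints ℝ).ncard := by
  have := hP.finite_extremePoints.fintype
  obtain ⟨p, hp⟩ := (hP.preconnected_edgeGraph u w).exists_isPath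
  exact ⟨p, by simpa only [← Nat.card_coe_set_eq, Nat.card_eq_fintype_card] using hp.length_lt⟩

end EdgeGraph

section Lattice

variable {n : ℕ}

lemma mem_intLattice {x : Fin n → ℝ} : x ∈ intLattice n ↔ ∀ i, ∃ k : ℤ, x i = k := by
  refine ⟨fun ⟨z, hz⟩ i => ⟨z i, hz ▸ rfl⟩, fun h => ?_⟩
  choose z hz using h
  exact ⟨z, funext fun i => (hz i).symm⟩

lemma neg_mem_intLattice {x : Fin n → ℝ} (hx : x ∈ intLattice n) : -x ∈ intLattice n := by
  obtain ⟨a, rfl⟩ := hx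
  exact ⟨-a, by ext; simp⟩

lemma add_mem_intLattice {x y : Fin n → ℝ} (hx : x ∈ intLattice n) (hy : y ∈ intLattice n) :
    x + y ∈ intLattice n := by
  obtain ⟨a, rfl⟩ := hx
  obtain ⟨b, rfl⟩ := hy
  exact ⟨a + b, by ext; simp⟩

lemma sub_mem_intLattice {x y : Fin n → ℝ} (hx : x ∈ intLattice n) (hy : y ∈ intLattice n) :
    x - y ∈ intLattice n :=
  sub_eq_add_neg x y ▸ add_mem_intLattice hx (neg_mem_intLattice hy)

lemma nsmul_mem_intLattice {x : Fin n → ℝ} (hx : x ∈ intLattice n) (k : ℕ) :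
    (k : ℝ) • x ∈ intLattice n := by
  obtain ⟨a, rfl⟩ := hx
  exact ⟨k • a, by ext; simp⟩

lemma finite_intLattice_norm_le (n : ℕ) (r : ℝ) : {x ∈ intLattice n | ‖x‖ ≤ r}.Finite := by
  refine ((Set.finite_Icc (fun _ : Fin n => ⌊-r⌋) (fun _ => ⌈r⌉)).image
    (fun (z : Fin n → ℤ) (i : Fin n) => (z i : ℝ))).subset ?_
  rintro x ⟨⟨z, rfl⟩, hz⟩
  have habs (i : Fin n) : |(z i : ℝ)| ≤ r := (norm_le_pi_norm (fun i => (z i : ℝ)) i).trans hz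
  exact ⟨z, ⟨fun i => by exact_mod_cast (Int.floor_le (-r)).trans (abs_le.1 (habs i)).1,
    fun i => by exact_mod_cast (abs_le.1 (habs i)).2.trans (Int.le_ceil r)⟩, rfl⟩

lemma IsLatticePolytope.isPolytope {P : Set (Fin n → ℝ)} (h : IsLatticePolytope P) :
    IsPolytope P := by
  obtain ⟨S, hS, -, rfl⟩ := h
  exact isPolytope_convexHull hS

lemma IsLatticePolytope.extremePoints_subset {P : Set (Fin n → ℝ)} (h : IsLatticePolytope P) :
    P.extremePoints ℝ ⊆ intLattice n := by
  obtain ⟨S, -, hS, rfl⟩ := h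
  exact extremePoints_convexHull_subset.trans hS

lemma abs_le_of_add_smul_mem {P : Set (Fin n → ℝ)} (hP : Convex ℝ P) {K : ℕ}
    (hK : (P ∩ intLattice n).encard ≤ K) {p v : Fin n → ℝ} (hp : p ∈ P ∩ intLattice n)
    (hv : v ∈ intLattice n) (hv0 : v ≠ 0) {t : ℝ} (ht : p + t • v ∈ P) : |t| ≤ K := by
  wlog ht0 : 0 ≤ t generalizing t v
  · rw [← abs_neg]
    exact this (neg_mem_intLattice hv) (neg_ne_zero.2 hv0) (by simpa using ht) (by linarith)
  rw [abs_of_nonneg ht0]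
  by_contra! hKt
  have htpos : 0 < t := (Nat.cast_nonneg K).trans_lt hKt
  have hsub : (fun k : ℕ => p + (k : ℝ) • v) '' Set.Iic K ⊆ P ∩ intLattice n := by
    rintro _ ⟨k, hk, rfl⟩
    have hkt : (k : ℝ) ≤ t := (Nat.cast_le.2 hk).trans hKt.le
    refine ⟨?_, add_mem_intLattice hp.2 (nsmul_mem_intLattice hv k)⟩
    have hmem := hP.add_smul_mem hp.1 ht (t := k / t) ⟨by positivity, (div_le_one htpos).2 hkt⟩
    rwa [smul_smul, div_mul_cancel₀ _ htpos.ne'] at hmem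
  have hinj : Function.Injective fun k : ℕ => p + (k : ℝ) • v := fun k l hkl =>
    Nat.cast_injective (R := ℝ) (smul_left_injective ℝ hv0 (add_left_cancel hkl))
  have hcard := (Set.encard_le_encard hsub).trans hK
  rw [hinj.encard_image, ← Finset.coe_Iic, Set.encard_coe_eq_coe_finsetCard, Nat.card_Iic] at hcard
  exact absurd (Nat.cast_le.1 hcard) (Nat.not_succ_le_self K)

-- The `2 × 2` minors of `(a, z)` are `q` times those of `(a, b)`, and they are integers.
lemma exists_one_le_mul_abs_coeff {a b : Fin n → ℝ} (ha : a ∈ intLattice n)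
    (hab : LinearIndependent ℝ ![a, b]) :
    ∃ M : ℝ, ∀ p q : ℝ, p • a + q • b ∈ intLattice n → q ≠ 0 → 1 ≤ M * |q| := by
  obtain ⟨i, j, hij⟩ : ∃ i j, a i * b j - a j * b i ≠ 0 := by
    by_contra! h
    refine hab.ne_zero 0 (funext fun i => ?_)
    refine neg_eq_zero.1 (LinearIndependent.pair_iff.1 hab (b i) (-a i) (funext fun j => ?_)).2
    simp only [Pi.add_apply, Pi.smul_apply, smul_eq_mul, Pi.zero_apply]
    linear_combination -h i j
  refine ⟨|a i * b j - a j * b i|, fun p q hz hq => ?_⟩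
  obtain ⟨⟨ai, hai⟩, ⟨aj, haj⟩⟩ := mem_intLattice.1 ha i, mem_intLattice.1 ha j
  obtain ⟨⟨zi, hzi⟩, ⟨zj, hzj⟩⟩ := mem_intLattice.1 hz i, mem_intLattice.1 hz j
  have hminor : (a i * b j - a j * b i) * q = ((ai * zj - aj * zi : ℤ) : ℝ) := by
    push_cast
    rw [← hai, ← haj, ← hzi, ← hzj]
    simp only [Pi.add_apply, Pi.smul_apply, smul_eq_mul]
    ring
  have hne : (ai * zj - aj * zi : ℤ) ≠ 0 := fun h =>
    mul_ne_zero hij hq (by rw [hminor, h, Int.cast_zero])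
  rw [← abs_mul, hminor]
  exact_mod_cast Int.one_le_abs hne

lemma exists_forall_one_le_mul_abs_coeff {E : Set (Fin n → ℝ)} (hE : E.Finite)
    (hEL : E ⊆ intLattice n) :
    ∃ M : ℝ, 1 ≤ M ∧ ∀ a ∈ E, ∀ b ∈ E, LinearIndependent ℝ ![a, b] →
      ∀ p q : ℝ, p • a + q • b ∈ intLattice n → q ≠ 0 → 1 ≤ M * |q| := by
  have h : ∀ᶠ M : ℝ in Filter.atTop, ∀ a ∈ E, ∀ b ∈ E, LinearIndependent ℝ ![a, b] →
      ∀ p q : ℝ, p • a + q • b ∈ intLattice n → q ≠ 0 → 1 ≤ M * |q| := by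
    refine (Filter.eventually_all_finite hE).2 fun a ha =>
      (Filter.eventually_all_finite hE).2 fun b _ =>
        Filter.eventually_imp_distrib_left.2 fun hab => ?_
    obtain ⟨M, hM⟩ := exists_one_le_mul_abs_coeff (hEL ha) hab
    filter_upwards [Filter.eventually_ge_atTop M] with M' hM' p q hz hq
    exact (hM p q hz hq).trans (mul_le_mul_of_nonneg_right hM' (abs_nonneg q))
  exact ((Filter.eventually_ge_atTop 1).and h).exists

lemma finite_linearMap_mapsTo {V W : Type*} [AddCommGroup V] [Module ℝ V] [AddCommGroup W]
    [Module ℝ W] {G : Set V} {E : Set W} (hG : G.Finite) (hE : E.Finite) :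
    {A : V →ₗ[ℝ] W | ∃ H ⊆ G, Submodule.span ℝ H = ⊤ ∧ Set.MapsTo A H E}.Finite := by
  refine (Set.Finite.biUnion hG.finite_subsets fun H hH => ?_).subset
    (s := ⋃ H ∈ {H | H ⊆ G}, {A : V →ₗ[ℝ] W | Submodule.span ℝ H = ⊤ ∧ Set.MapsTo A H E})
    fun A ⟨H, hH, hA⟩ => Set.mem_iUnion₂.2 ⟨H, hH, hA⟩
  have : Finite H := (hG.subset hH).to_subtype
  refine Set.Finite.of_injOn (f := fun (A : V →ₗ[ℝ] W) (x : H) => A x)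
    (t := Set.pi Set.univ fun _ => E) (fun A hA x _ => hA.2 x.2) (fun A hA B _ hAB => ?_)
    (Set.Finite.pi fun _ => hE)
  exact LinearMap.ext_on hA.1 fun x hx => congrFun hAB ⟨x, hx⟩

lemma abs_coeff_le_mul_max {P : Set (Fin n → ℝ)} (hP : Convex ℝ P) {K : ℕ}
    (hK : (P ∩ intLattice n).encard ≤ K) {u v w w' : Fin n → ℝ} (hu : u ∈ P)
    (hv : v ∈ intLattice n) (hv0 : v ≠ 0) (hw : w ∈ P ∩ intLattice n)
    (hw' : w' ∈ P ∩ intLattice n) {a c : ℝ} (ha : 0 < a) (h : w' - u = a • (w - u) + c • v) :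
    |c| ≤ K * max 1 a := by
  obtain h1 | h1 := le_total 1 a
  · have hmem : w + (c / a) • v ∈ P := by
      have hconv := hP.add_smul_sub_mem hu hw'.1 (t := a⁻¹)
        ⟨inv_nonneg.2 ha.le, inv_le_one_of_one_le₀ h1⟩
      rwa [h, smul_add, inv_smul_smul₀ ha.ne', smul_smul, ← div_eq_inv_mul, ← add_assoc,
        add_sub_cancel] at hconv
    have hle := abs_le_of_add_smul_mem hP hK hw hv hv0 hmem
    rwa [abs_div, abs_of_pos ha, div_le_iff₀ ha, ← max_eq_right h1] at hle
  · have hmem : w' + (-c) • v ∈ P := by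
      have hconv := hP.add_smul_sub_mem hu hw.1 (t := a) ⟨ha.le, h1⟩
      convert hconv using 1
      linear_combination (norm := module) h
    have hle := abs_le_of_add_smul_mem hP hK hw' hv hv0 hmem
    rwa [abs_neg, ← mul_one (K : ℝ), ← max_eq_left h1] at hle

end Lattice

section Framed

variable {d : ℕ}

lemma norm_sub_le_of_coeff_le {P : Set (Fin d → ℝ)} (hP : Convex ℝ P) {K : ℕ}
    (hK : (P ∩ intLattice d).encard ≤ K) (hPL : P.extremePoints ℝ ⊆ intLattice d)
    {u u' w w' : Fin d → ℝ} (huu' : IsEdge P u u') (huw : IsEdge P u w) (huw' : IsEdge P u' w')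
    {a b M r : ℝ} (ha : 0 < a) (haM : a ≤ M) (hM : 1 ≤ M)
    (h : w' - u' = a • (w - u) + b • (u' - u)) (hw : ‖w - u‖ ≤ r) (hu' : ‖u' - u‖ ≤ r) :
    ‖w' - u'‖ ≤ (M + (K * M + 1)) * r := by
  have hvertex {x : Fin d → ℝ} (hx : x ∈ P.extremePoints ℝ) : x ∈ P ∩ intLattice d :=
    ⟨hx.1, hPL hx⟩
  have hb : |1 + b| ≤ K * M := by
    have hle := abs_coeff_le_mul_max hP hK huu'.left_mem.1
      (sub_mem_intLattice (hPL huu'.right_mem) (hPL huu'.left_mem)) (sub_ne_zero.2 huu'.1.symm)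
      (hvertex huw.right_mem) (hvertex huw'.right_mem) ha (c := 1 + b)
      (by linear_combination (norm := module) h)
    exact hle.trans (mul_le_mul_of_nonneg_left (max_le hM haM) (Nat.cast_nonneg K))
  have hb' : |b| ≤ K * M + 1 := by
    rw [abs_le] at hb ⊢
    constructor <;> linarith
  calc ‖w' - u'‖ ≤ a * ‖w - u‖ + |b| * ‖u' - u‖ := by
        rw [h, ← Real.norm_eq_abs, ← norm_smul, ← Real.norm_of_nonneg ha.le, ← norm_smul,
          Real.norm_of_nonneg ha.le]
        exact norm_add_le _ _
    _ ≤ M * r + (K * M + 1) * r := by gcongr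
    _ = (M + (K * M + 1)) * r := by ring

-- Solving the parallelism relation for `A (w - u)`, an integer vector, bounds `a⁻¹` from below.
lemma AreParallelEdges.norm_sub_le {P : Set (Fin d → ℝ)} (hP : Convex ℝ P) {K : ℕ}
    (hK : (P ∩ intLattice d).encard ≤ K) (hPL : P.extremePoints ℝ ⊆ intLattice d)
    {u u' w w' : Fin d → ℝ} (h : AreParallelEdges P u u' w w') (huu' : IsEdge P u u')
    {E : Set (Fin d → ℝ)} {A : (Fin d → ℝ) ≃ₗ[ℝ] (Fin d → ℝ)}
    (hAL : ∀ x ∈ intLattice d, A x ∈ intLattice d)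
    (hAE : ∀ x, IsEdge P u' x → A (x - u') ∈ E) {M r : ℝ} (hM : 1 ≤ M)
    (hME : ∀ α ∈ E, ∀ β ∈ E, LinearIndependent ℝ ![α, β] →
      ∀ p q : ℝ, p • α + q • β ∈ intLattice d → q ≠ 0 → 1 ≤ M * |q|)
    (hr : ∀ x, IsEdge P u x → ‖x - u‖ ≤ r) : ‖w' - u'‖ ≤ (M + (K * M + 1)) * r := by
  obtain ⟨a, b, ha, hab⟩ := h.exists_eq
  refine norm_sub_le_of_coeff_le hP hK hPL huu' h.left h.right ha ?_ hM hab (hr w h.left)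
    (hr u' huu')
  have hwu : w - u = (b / a) • (u - u') + a⁻¹ • (w' - u') := by
    rw [hab, smul_add, inv_smul_smul₀ ha.ne']
    module
  have hind : LinearIndependent ℝ ![A (u - u'), A (w' - u')] := by
    have hne : A (u - u') ≠ 0 := A.map_ne_zero_iff.2 (sub_ne_zero.2 huu'.1)
    refine (LinearIndependent.pair_iff' hne).2 fun c hc => h.notMem_span ?_
    rw [← map_smul, A.injective.eq_iff] at hc
    refine Submodule.mem_span_singleton.2 ⟨-(b / a + a⁻¹ * c), ?_⟩
    rw [hwu, ← hc]
    module
  have hone := hME _ (hAE u huu'.symm) _ (hAE w' h.right) hind (b / a) a⁻¹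
    (by
      rw [← map_smul, ← map_smul, ← map_add, ← hwu]
      exact hAL _ (sub_mem_intLattice (hPL h.left.right_mem) (hPL h.left.left_mem)))
    (inv_ne_zero ha.ne')
  rwa [abs_of_pos (inv_pos.2 ha), ← div_eq_mul_inv, one_le_div ha] at hone

-- The edges at `u'` that are parallel to edges at `u`, together with `u - u'`, lie in a fixed
-- finite set and span, so `A` is one of finitely many linear maps.
lemma exists_forall_norm_sub_le {E : Set (Fin d → ℝ)} (hE : E.Finite) (hEL : E ⊆ intLattice d)
    (K : ℕ) (r : ℝ) :
    ∃ r' : ℝ, ∀ P : Set (Fin d → ℝ), IsLatticePolytope P → (P ∩ intLattice d).encard ≤ K →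
      vectorSpan ℝ P = ⊤ → ∀ u u', IsEdge P u u' → (∀ x, IsEdge P u x → ‖x - u‖ ≤ r) →
      ∀ A : (Fin d → ℝ) ≃ₗ[ℝ] (Fin d → ℝ), (∀ x ∈ intLattice d, A x ∈ intLattice d) →
      (∀ x, IsEdge P u' x → A (x - u') ∈ E) → ∀ x, IsEdge P u' x → ‖x - u'‖ ≤ r' := by
  obtain ⟨M, hM, hME⟩ := exists_forall_one_le_mul_abs_coeff hE hEL
  set G := {x ∈ intLattice d | ‖x‖ ≤ max r ((M + (K * M + 1)) * r)}
  have hfin : {A : (Fin d → ℝ) ≃ₗ[ℝ] (Fin d → ℝ) |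
      ∃ H ⊆ G, Submodule.span ℝ H = ⊤ ∧ Set.MapsTo A H E}.Finite :=
    (finite_linearMap_mapsTo (finite_intLattice_norm_le d _) hE).preimage
      (f := LinearEquiv.toLinearMap) LinearEquiv.toLinearMap_injective.injOn
  obtain ⟨r', hr'⟩ := (hfin.biUnion fun A _ => hE.image A.symm).isBounded.exists_norm_le
  refine ⟨r', fun P hP hK hspan u u' huu' hr A hAL hAE x hx => hr' _ (Set.mem_biUnion
    (x := A) ⟨_, ?_, top_unique (hspan ▸ huu'.vectorSpan_le hP.isPolytope), ?_⟩
    ⟨_, hAE x hx, A.symm_apply_apply _⟩)⟩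
  · have hdiff {y z : Fin d → ℝ} (h : IsEdge P z y) : y - z ∈ intLattice d :=
      sub_mem_intLattice (hP.extremePoints_subset h.right_mem) (hP.extremePoints_subset h.left_mem)
    rintro _ (rfl | ⟨w, w', hww', rfl⟩)
    · exact ⟨hdiff huu'.symm, le_max_of_le_left (norm_sub_rev u u' ▸ hr u' huu')⟩
    · exact ⟨hdiff hww'.right, le_max_of_le_right (hww'.norm_sub_le hP.isPolytope.convex hK
        hP.extremePoints_subset huu' hAL hAE hM hME hr)⟩
  · rintro _ (rfl | ⟨w, w', hww', rfl⟩)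
    · exact hAE u huu'.symm
    · exact hAE w' hww'.right

/-- Full-dimensional lattice polytopes with at most `K` lattice points and a vertex at the origin,
whose edge vectors at every vertex are, after a linear automorphism of `ℤᵈ` depending on the vertex,
in a given set `E`. At the origin no automorphism is allowed: this makes the class finite. -/
structure IsFramed (K : ℕ) (E P : Set (Fin d → ℝ)) : Prop where
  isLatticePolytope : IsLatticePolytope P
  encard_le : (P ∩ intLattice d).encard ≤ K
  vectorSpan_eq_top : vectorSpan ℝ P = ⊤
  zero_mem : 0 ∈ P.extremePoints ℝ
  mem_of_isEdge_zero : ∀ w, IsEdge P 0 w → w ∈ E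
  exists_linearEquiv : ∀ u ∈ P.extremePoints ℝ, ∃ A : (Fin d → ℝ) ≃ₗ[ℝ] (Fin d → ℝ),
    (∀ x ∈ intLattice d, A x ∈ intLattice d) ∧ ∀ w, IsEdge P u w → A (w - u) ∈ E

lemma exists_forall_norm_le_of_walk {E : Set (Fin d → ℝ)} (hE : E.Finite)
    (hEL : E ⊆ intLattice d) (K k : ℕ) :
    ∃ r : ℝ, ∀ P : Set (Fin d → ℝ), ∀ h : IsFramed K E P, ∀ u : P.extremePoints ℝ,
      ∀ p : (edgeGraph P).Walk u ⟨0, h.zero_mem⟩, p.length = k →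
        ‖(u : Fin d → ℝ)‖ ≤ r ∧ ∀ w, IsEdge P u w → ‖w - u‖ ≤ r := by
  induction k with
  | zero =>
    obtain ⟨r, hr⟩ := hE.isBounded.exists_norm_le
    refine ⟨max r 0, fun P h u p hp => ?_⟩
    obtain rfl := SimpleGraph.Walk.eq_of_length_eq_zero hp
    refine ⟨by simp, fun w hw => ?_⟩
    rw [sub_zero]
    exact le_max_of_le_left (hr w (h.mem_of_isEdge_zero w hw))
  | succ k ih =>
    obtain ⟨r, hr⟩ := ih
    obtain ⟨r', hr'⟩ := exists_forall_norm_sub_le hE hEL K r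
    refine ⟨max (r + r) r', fun P h u p hp => ?_⟩
    cases p with
    | nil => simp at hp
    | cons hadj q =>
      obtain ⟨hnorm, hedges⟩ := hr P h _ q (Nat.succ_injective hp)
      obtain ⟨A, hAL, hAE⟩ := h.exists_linearEquiv u u.2
      refine ⟨le_max_of_le_left ?_, fun w hw => le_max_of_le_right (hr' P h.isLatticePolytope
        h.encard_le h.vectorSpan_eq_top _ _ hadj.symm hedges A hAL hAE w hw)⟩
      exact (norm_le_norm_add_norm_sub' _ _).trans (add_le_add hnorm (hedges u hadj.symm))

theorem finite_isFramed {E : Set (Fin d → ℝ)} (hE : E.Finite) (hEL : E ⊆ intLattice d) (K : ℕ) :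
    {P | IsFramed K E P}.Finite := by
  choose r hr using exists_forall_norm_le_of_walk hE hEL K
  have hfin : (⋃ k ∈ Set.Iio K, {x ∈ intLattice d | ‖x‖ ≤ r k}).Finite :=
    (Set.finite_Iio K).biUnion fun k _ => finite_intLattice_norm_le d (r k)
  refine (hfin.finite_subsets.image (convexHull ℝ)).subset fun P h => ?_
  have hPL := h.isLatticePolytope.extremePoints_subset
  refine ⟨P.extremePoints ℝ, fun u hu => ?_,
    h.isLatticePolytope.isPolytope.convexHull_extremePoints⟩
  have hcard : (P.extremePoints ℝ).ncard ≤ K := ENat.toNat_le_of_le_natCast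
    ((Set.encard_le_encard (Set.subset_inter extremePoints_subset hPL)).trans h.encard_le)
  obtain ⟨p, hp⟩ := h.isLatticePolytope.isPolytope.exists_walk_length_lt ⟨u, hu⟩ ⟨0, h.zero_mem⟩
  exact Set.mem_biUnion (Set.mem_Iio.2 (hp.trans_le hcard)) ⟨hPL hu, (hr _ P h ⟨u, hu⟩ p rfl).1⟩

end Framed

section Duality

lemma exists_forall_pos {V : Type*} [NormedAddCommGroup V] [NormedSpace ℝ V]
    {C : PointedCone ℝ V} (hC : C.toConvexCone.Salient) (hfg : C.FG) :
    ∃ f : Module.Dual ℝ V, ∀ y ∈ C, y ≠ 0 → 0 < f y := by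
  obtain ⟨S, rfl⟩ := hfg
  set C := Submodule.span {c : ℝ // 0 ≤ c} (S : Set V)
  have hconv : Convex ℝ ((C : Set V) \ {0}) := by
    rintro y ⟨hy, hy0⟩ z ⟨hz, hz0⟩ a b ha hb hab
    refine ⟨PointedCone.convex C hy hz ha hb hab, fun h => ?_⟩
    have hay := (smul_eq_zero.1 (eq_zero_of_add_eq_zero hC (PointedCone.smul_mem C ha hy)
      (PointedCone.smul_mem C hb hz) h)).resolve_right hy0
    obtain rfl : b = 1 := by linarith
    exact hz0 (by simpa [hay] using h)
  have hsub : (S : Set V) \ {0} ⊆ (C : Set V) \ {0} :=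
    Set.sdiff_subset_sdiff_left Submodule.subset_span
  obtain ⟨f, r, hf0, hf⟩ := geometric_hahn_banach_point_closed (convex_convexHull ℝ _)
    ((S.finite_toSet.sdiff (t := {0})).isCompact_convexHull ℝ).isClosed
    fun h => (convexHull_min hsub hconv h).2 rfl
  have hpos : ∀ y ∈ (S : Set V) \ {0}, 0 < f y := fun y hy =>
    (map_zero f ▸ hf0).trans (hf y (subset_convexHull ℝ _ hy))
  refine ⟨f, fun y hy => or_iff_not_imp_left.1 ?_⟩
  induction hy using Submodule.span_induction with
  | mem y hy => exact or_iff_not_imp_left.2 fun hy0 => hpos y ⟨hy, hy0⟩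
  | zero => exact Or.inl rfl
  | add y z _ _ hy hz =>
    obtain rfl | hy := hy
    · simpa only [zero_add] using hz
    obtain rfl | hz := hz
    · exact Or.inr (by simpa only [add_zero] using hy)
    · exact Or.inr (by simpa only [map_add] using add_pos hy hz)
  | smul a y _ hy =>
    obtain rfl | ha := eq_zero_or_pos a
    · exact Or.inl (zero_smul _ y)
    obtain rfl | hy := hy
    · exact Or.inl (smul_zero a)
    · exact Or.inr ((mul_pos (a := (a : ℝ)) ha hy).trans_eq (map_smul f (a : ℝ) y).symm)

lemma salient_hull_insert_neg {V : Type*} [AddCommGroup V] [Module ℝ V] {S : Set V}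
    (hS : (PointedCone.hull ℝ S).toConvexCone.Salient) {x : V} (hx : x ∉ PointedCone.hull ℝ S) :
    (PointedCone.hull ℝ (insert (-x) S)).toConvexCone.Salient := by
  intro y hy hy0 hy'
  obtain ⟨a, ha, p, hp, hyp⟩ := mem_hull_insert.1 hy
  obtain ⟨b, hb, q, hq, hyq⟩ := mem_hull_insert.1 hy'
  have hsum : (a + b) • x = p + q := by linear_combination (norm := module) hyp + hyq
  obtain hab | hab := (add_nonneg ha hb).eq_or_lt
  · obtain ⟨rfl, rfl⟩ : a = 0 ∧ b = 0 := ⟨by linarith, by linarith⟩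
    rw [zero_smul, zero_add] at hyp hyq
    exact hS y (hyp ▸ hp) hy0 (hyq ▸ hq)
  · exact hx ((PointedCone.smul_mem_iff _ hab).1 (hsum ▸ Submodule.add_mem _ hp hq))

lemma exists_forall_nonneg_of_notMem {V : Type*} [NormedAddCommGroup V] [NormedSpace ℝ V]
    {C : PointedCone ℝ V} (hC : C.toConvexCone.Salient) (hfg : C.FG) {x : V} (hx : x ∉ C) :
    ∃ f : Module.Dual ℝ V, (∀ y ∈ C, 0 ≤ f y) ∧ f x < 0 := by
  obtain ⟨S, rfl⟩ := hfg
  obtain ⟨f, hf⟩ := exists_forall_pos (salient_hull_insert_neg hC hx)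
    (Submodule.fg_span (S.finite_toSet.insert (-x)))
  have hx0 : -x ≠ 0 := neg_ne_zero.2 fun h => hx (h ▸ Submodule.zero_mem _)
  refine ⟨f, fun y hy => ?_, ?_⟩
  · obtain rfl | hy0 := eq_or_ne y 0
    · exact (map_zero f).ge
    · exact (hf y (Submodule.span_mono (Set.subset_insert _ _) hy) hy0).le
  · simpa using hf (-x) (PointedCone.subset_hull (Set.mem_insert _ _)) hx0

lemma exists_linearEquiv_of_dual {V W : Type*} [AddCommGroup V] [Module ℝ V]
    [FiniteDimensional ℝ V] [AddCommGroup W] [Module ℝ W] [FiniteDimensional ℝ W]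
    (e : Module.Dual ℝ V ≃ₗ[ℝ] Module.Dual ℝ W) :
    ∃ θ : V ≃ₗ[ℝ] W, ∀ ψ x, e ψ (θ x) = ψ x := by
  refine ⟨Module.evalEquiv ℝ V ≪≫ₗ e.symm.dualMap ≪≫ₗ (Module.evalEquiv ℝ W).symm,
    fun ψ x => ?_⟩
  simp

lemma ConesEquivalent.symm {V W : Type*} [AddCommGroup V] [Module ℝ V] [AddCommGroup W]
    [Module ℝ W] {Λ : Set V} {σ : PointedCone ℝ V} {Γ : Set W} {τ : PointedCone ℝ W}
    (h : ConesEquivalent Λ σ Γ τ) : ConesEquivalent Γ τ Λ σ := by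
  obtain ⟨f, hL, hC⟩ := h
  exact ⟨f.symm, fun x => by rw [hL, f.apply_symm_apply], fun x => by rw [hC, f.apply_symm_apply]⟩

lemma ConesEquivalent.trans {V W X : Type*} [AddCommGroup V] [Module ℝ V] [AddCommGroup W]
    [Module ℝ W] [AddCommGroup X] [Module ℝ X] {Λ : Set V} {σ : PointedCone ℝ V} {Γ : Set W}
    {τ : PointedCone ℝ W} {Δ : Set X} {υ : PointedCone ℝ X} (h : ConesEquivalent Λ σ Γ τ)
    (h' : ConesEquivalent Γ τ Δ υ) : ConesEquivalent Λ σ Δ υ := by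
  obtain ⟨f, hfL, hfC⟩ := h
  obtain ⟨g, hgL, hgC⟩ := h'
  exact ⟨f ≪≫ₗ g, fun x => (hfL x).trans (hgL _), fun x => (hfC x).trans (hgC _)⟩

lemma ConesEquivalent.exists_linearEquiv {V W : Type*} [AddCommGroup V] [Module ℝ V]
    [AddCommGroup W] [Module ℝ W] {Λ : Set V} {σ : PointedCone ℝ V} {Γ : Set W}
    {τ : PointedCone ℝ W} (h : ConesEquivalent Λ σ Γ τ)
    (hσ : Submodule.span ℝ (σ : Set V) = ⊤) (hτ : Submodule.span ℝ (τ : Set W) = ⊤) :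
    ∃ e : V ≃ₗ[ℝ] W, (∀ x, x ∈ Λ ↔ e x ∈ Γ) ∧ ∀ x, x ∈ σ ↔ e x ∈ τ := by
  obtain ⟨f, hL, hC⟩ := h
  exact ⟨(LinearEquiv.ofTop _ hσ).symm ≪≫ₗ f ≪≫ₗ LinearEquiv.ofTop _ hτ,
    fun x => hL ((LinearEquiv.ofTop _ hσ).symm x), fun x => hC ((LinearEquiv.ofTop _ hσ).symm x)⟩

end Duality

section NormalCone

variable {n : ℕ} {P : Set (Fin n → ℝ)} {u : Fin n → ℝ}

lemma exists_lattice_coordinates {d : ℕ} (W : Submodule ℝ (Fin n → ℝ))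
    (hW : W ≤ Submodule.span ℝ ((W : Set (Fin n → ℝ)) ∩ intLattice n))
    (hd : Module.finrank ℝ W = d) :
    ∃ φ : W ≃ₗ[ℝ] (Fin d → ℝ), ∀ x : W, (x : Fin n → ℝ) ∈ intLattice n ↔ φ x ∈ intLattice d := by
  set Λ : Submodule ℤ (Fin n → ℝ) := Submodule.span ℤ (Set.range (Pi.basisFun ℝ (Fin n)))
  set L : Submodule ℤ W := ZLattice.comap ℝ Λ W.subtype
  have hL (x : W) : x ∈ L ↔ (x : Fin n → ℝ) ∈ intLattice n := by
    refine ((Pi.basisFun ℝ (Fin n)).mem_span_iff_repr_mem ℤ (x : Fin n → ℝ)).trans ?_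
    simp [mem_intLattice, eq_comm]
  have : DiscreteTopology L :=
    ZLattice.comap_discreteTopology ℝ Λ continuous_subtype_val W.injective_subtype
  have : IsZLattice ℝ L := by
    refine ⟨Submodule.map_injective_of_injective W.injective_subtype ?_⟩
    rw [Submodule.map_span, Submodule.map_top, Submodule.range_subtype]
    refine le_antisymm (Submodule.span_le.2 ?_) (hW.trans (Submodule.span_mono ?_))
    · rintro _ ⟨x, -, rfl⟩
      exact x.2
    · rintro x ⟨hx, hxL⟩
      exact ⟨⟨x, hx⟩, (hL _).2 hxL, rfl⟩
  have hcard : Fintype.card (Module.Free.ChooseBasisIndex ℤ L) = Fintype.card (Fin d) := by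
    rw [← Module.finrank_eq_card_chooseBasisIndex, ZLattice.rank ℝ L, hd, Fintype.card_fin]
  let b := (Module.Free.chooseBasis ℤ L).reindex (Fintype.equivOfCardEq hcard)
  refine ⟨(b.ofZLatticeBasis ℝ L).equivFun, fun x => ?_⟩
  rw [← hL, mem_intLattice]
  conv_lhs => rw [← b.ofZLatticeBasis_span ℝ L]
  rw [Module.Basis.mem_span_iff_repr_mem]
  simp [eq_comm]

lemma IsLatticePolytope.dirSpace_le_span (hP : IsLatticePolytope P) :
    dirSpace P ≤ Submodule.span ℝ ((dirSpace P : Set (Fin n → ℝ)) ∩ intLattice n) := by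
  obtain ⟨S, -, hSL, rfl⟩ := hP
  have hdir : dirSpace (convexHull ℝ S) = Submodule.span ℝ (S -ᵥ S) := by
    rw [dirSpace, affineSpan_convexHull, direction_affineSpan, vectorSpan_def]
  rw [hdir]
  refine Submodule.span_mono fun x hx => ⟨Submodule.subset_span hx, ?_⟩
  obtain ⟨a, ha, b, hb, rfl⟩ := hx
  exact sub_mem_intLattice (hSL ha) (hSL hb)

lemma IsLatticePolytope.mem_intLattice_iff_forall_dualLattice (hP : IsLatticePolytope P)
    {x : dirSpace P} :
    (x : Fin n → ℝ) ∈ intLattice n ↔ ∀ ψ ∈ dualLattice P, ∃ k : ℤ, ψ x = k := by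
  refine ⟨fun hx ψ hψ => hψ x hx, fun h => ?_⟩
  obtain ⟨φ, hφ⟩ := exists_lattice_coordinates (dirSpace P) hP.dirSpace_le_span rfl
  refine (hφ x).2 (mem_intLattice.2 fun i => h (LinearMap.proj i ∘ₗ φ.toLinearMap) fun y hy => ?_)
  exact mem_intLattice.1 ((hφ y).1 hy) i

lemma map_subtype_tangentCone (hu : u ∈ P) :
    (tangentCone P u).map (dirSpace P).subtype = dirCone P u := by
  rw [tangentCone, dirCone, PointedCone.map, Submodule.map_span]
  congr 1
  ext x
  refine ⟨fun ⟨_, hy, h⟩ => h ▸ hy, fun hx => ⟨⟨x, ?_⟩, hx, rfl⟩⟩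
  have h := AffineSubspace.vsub_mem_direction (subset_affineSpan ℝ P hx) (subset_affineSpan ℝ P hu)
  simpa using h

lemma mem_tangentCone_iff (hu : u ∈ P) {x : dirSpace P} :
    x ∈ tangentCone P u ↔ (x : Fin n → ℝ) ∈ dirCone P u := by
  rw [← map_subtype_tangentCone hu, PointedCone.mem_map]
  exact ⟨fun hx => ⟨x, hx, rfl⟩, fun ⟨y, hy, h⟩ => Subtype.ext h ▸ hy⟩

lemma IsPolytope.mem_tangentCone_iff_forall_normalCone (hP : IsPolytope P)
    (hu : u ∈ P.extremePoints ℝ) {x : dirSpace P} :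
    x ∈ tangentCone P u ↔ ∀ ψ ∈ normalCone P u, 0 ≤ ψ x := by
  refine ⟨fun hx ψ hψ => hψ hx, fun h => ?_⟩
  by_contra hx
  rw [mem_tangentCone_iff hu.1] at hx
  obtain ⟨f, hf, hfx⟩ :=
    exists_forall_nonneg_of_notMem (salient_dirCone hP.convex hu) (hP.fg_dirCone u) hx
  exact hfx.not_ge (h (f ∘ₗ (dirSpace P).subtype)
    fun y hy => hf y ((mem_tangentCone_iff hu.1).1 hy))

lemma IsPolytope.span_normalCone (hP : IsPolytope P) (hu : u ∈ P.extremePoints ℝ) :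
    Submodule.span ℝ (normalCone P u : Set (Module.Dual ℝ (dirSpace P))) = ⊤ := by
  rw [← Subspace.dualCoannihilator_dualAnnihilator_eq
    (W := Submodule.span ℝ (normalCone P u : Set (Module.Dual ℝ (dirSpace P)))),
    Submodule.dualAnnihilator_eq_top_iff, eq_bot_iff]
  intro x hx
  have hzero : ∀ ψ ∈ normalCone P u, ψ x = 0 := fun ψ hψ =>
    (Submodule.mem_dualCoannihilator x).1 hx ψ (Submodule.subset_span hψ)
  have hmem : x ∈ tangentCone P u :=
    (hP.mem_tangentCone_iff_forall_normalCone hu).2 fun ψ hψ => (hzero ψ hψ).ge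
  have hneg : -x ∈ tangentCone P u :=
    (hP.mem_tangentCone_iff_forall_normalCone hu).2 fun ψ hψ => by
      rw [map_neg, hzero ψ hψ, neg_zero]
  rw [mem_tangentCone_iff hu.1] at hmem hneg
  exact Subtype.ext (eq_zero_of_add_eq_zero (salient_dirCone hP.convex hu) hmem hneg (by simp))

lemma exists_linearEquiv_tangentCone {n' : ℕ} {P' : Set (Fin n' → ℝ)} {u' : Fin n' → ℝ}
    (hP : IsLatticePolytope P) (hP' : IsLatticePolytope P') (hu : u ∈ P.extremePoints ℝ)
    (hu' : u' ∈ P'.extremePoints ℝ)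
    (h : ConesEquivalent (dualLattice P) (normalCone P u) (dualLattice P') (normalCone P' u')) :
    ∃ θ : dirSpace P ≃ₗ[ℝ] dirSpace P',
      (∀ x : dirSpace P, (x : Fin n → ℝ) ∈ intLattice n ↔ (θ x : Fin n' → ℝ) ∈ intLattice n') ∧
      (tangentCone P u).map (θ : dirSpace P →ₗ[ℝ] dirSpace P') = tangentCone P' u' := by
  obtain ⟨e, heL, heC⟩ := h.exists_linearEquiv (hP.isPolytope.span_normalCone hu)
    (hP'.isPolytope.span_normalCone hu')
  obtain ⟨θ, hθ⟩ := exists_linearEquiv_of_dual e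
  have hcone (x) : x ∈ tangentCone P u ↔ θ x ∈ tangentCone P' u' := by
    rw [hP.isPolytope.mem_tangentCone_iff_forall_normalCone hu,
      hP'.isPolytope.mem_tangentCone_iff_forall_normalCone hu', e.surjective.forall]
    simp only [heC, hθ]
  refine ⟨θ, fun x => ?_, ?_⟩
  · rw [hP.mem_intLattice_iff_forall_dualLattice, hP'.mem_intLattice_iff_forall_dualLattice,
      e.surjective.forall]
    simp only [heL, hθ]
  · ext y
    rw [PointedCone.mem_map]
    exact ⟨fun ⟨x, hx, h⟩ => h ▸ (hcone x).1 hx,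
      fun hy => ⟨θ.symm y, (hcone _).2 (by simpa), by simp⟩⟩

end NormalCone

section EdgeVectors

/-- In suitable coordinates on the space parallel to `aff P`, under which its integer vectors become
`ℤᵈ`, all edge vectors of `P` at the vertex `u` lie in `E`. -/
def HasEdgesIn {n d : ℕ} (E : Set (Fin d → ℝ)) (P : Set (Fin n → ℝ)) (u : Fin n → ℝ) : Prop :=
  ∃ φ : dirSpace P ≃ₗ[ℝ] (Fin d → ℝ),
    (∀ x : dirSpace P, (x : Fin n → ℝ) ∈ intLattice n ↔ φ x ∈ intLattice d) ∧
    ∀ x : dirSpace P, IsEdge P u (u + x) → φ x ∈ E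

lemma HasEdgesIn.mono {n d : ℕ} {E E' : Set (Fin d → ℝ)} {P : Set (Fin n → ℝ)} {u : Fin n → ℝ}
    (h : HasEdgesIn E P u) (hE : E ⊆ E') : HasEdgesIn E' P u := by
  obtain ⟨φ, hφ, hφE⟩ := h
  exact ⟨φ, hφ, fun x hx => hE (hφE x hx)⟩

lemma IsEdge.isExtremeVec_tangentCone {n : ℕ} {P : Set (Fin n → ℝ)} (hP : Convex ℝ P)
    {u : Fin n → ℝ} {x : dirSpace P} (h : IsEdge P u (u + x)) :
    IsExtremeVec (tangentCone P u) x := by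
  rw [← isExtremeVec_map_iff (dirSpace P).injective_subtype,
    map_subtype_tangentCone h.left_mem.1, Submodule.subtype_apply]
  simpa using h.isExtremeVec hP

lemma IsPolytope.exists_pos_smul_mem_extremePoints {n : ℕ} {P : Set (Fin n → ℝ)}
    (hP : IsPolytope P) {u : Fin n → ℝ} (hu : u ∈ P) {x : dirSpace P}
    (hx : IsExtremeVec (tangentCone P u) x) :
    ∃ a : ℝ, 0 < a ∧ u + ((a • x : dirSpace P) : Fin n → ℝ) ∈ P.extremePoints ℝ := by
  rw [← isExtremeVec_map_iff (dirSpace P).injective_subtype, map_subtype_tangentCone hu,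
    hP.dirCone_eq] at hx
  obtain ⟨s, hs, a, ha, rfl⟩ := hx.exists_generator
  exact ⟨a, ha, hs⟩

-- The edge vectors of `P` at `u` correspond to submultiples of the vertex differences of a single
-- polytope with the same normal cone at a vertex.
lemma exists_finite_hasEdgesIn_of_conesEquivalent {n₀ d : ℕ} {P₀ : Set (Fin n₀ → ℝ)}
    {u₀ : Fin n₀ → ℝ} (hP₀ : IsLatticePolytope P₀) (hd : polytopeDim P₀ = d)
    (hu₀ : u₀ ∈ P₀.extremePoints ℝ) (K : ℕ) :
    ∃ E : Set (Fin d → ℝ), E.Finite ∧ E ⊆ intLattice d ∧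
      ∀ {n : ℕ} {P : Set (Fin n → ℝ)} {u : Fin n → ℝ}, IsLatticePolytope P →
        (P ∩ intLattice n).encard ≤ K → u ∈ P.extremePoints ℝ →
        ConesEquivalent (dualLattice P) (normalCone P u) (dualLattice P₀) (normalCone P₀ u₀) →
        HasEdgesIn E P u := by
  obtain ⟨φ₀, hφ₀⟩ := exists_lattice_coordinates (dirSpace P₀) hP₀.dirSpace_le_span hd
  set D : Set (dirSpace P₀) := {s | u₀ + (s : Fin n₀ → ℝ) ∈ P₀.extremePoints ℝ}
  have hD : D.Finite := hP₀.isPolytope.finite_extremePoints.preimage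
    ((add_right_injective u₀).comp Subtype.val_injective).injOn
  refine ⟨⋃ s ∈ D, {y ∈ intLattice d | ‖y‖ ≤ K * ‖φ₀ s‖},
    hD.biUnion fun s _ => finite_intLattice_norm_le d _,
    Set.iUnion₂_subset fun s _ => Set.sep_subset _ _, ?_⟩
  intro n P u hP hK hu h
  obtain ⟨θ, hθ, hθC⟩ := exists_linearEquiv_tangentCone hP hP₀ hu hu₀ h
  refine ⟨θ ≪≫ₗ φ₀, fun x => (hθ x).trans (hφ₀ _), fun x hx => ?_⟩
  have hext : IsExtremeVec (tangentCone P₀ u₀) (θ x) := by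
    rw [← hθC]
    exact (isExtremeVec_map_iff θ.injective).2 (hx.isExtremeVec_tangentCone hP.isPolytope.convex)
  obtain ⟨a, ha, hs⟩ := hP₀.isPolytope.exists_pos_smul_mem_extremePoints hu₀.1 hext
  have hxL : (x : Fin n → ℝ) ∈ intLattice n := by
    simpa using sub_mem_intLattice (hP.extremePoints_subset hx.right_mem)
      (hP.extremePoints_subset hu)
  refine Set.mem_biUnion (x := a • θ x) hs ⟨(hφ₀ _).1 ((hθ x).1 hxL), ?_⟩
  have haxL : ((a • x : dirSpace P) : Fin n → ℝ) ∈ intLattice n := by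
    rw [hθ, map_smul]
    simpa using sub_mem_intLattice (hP₀.extremePoints_subset hs) (hP₀.extremePoints_subset hu₀)
  have hax0 : ((a • x : dirSpace P) : Fin n → ℝ) ≠ 0 :=
    smul_ne_zero ha.ne' (by simpa using hx.1.symm)
  have hinv : |a⁻¹| ≤ K := abs_le_of_add_smul_mem hP.isPolytope.convex hK
    ⟨hu.1, hP.extremePoints_subset hu⟩ haxL hax0
    (by simpa [inv_smul_smul₀ ha.ne'] using hx.right_mem.1)
  calc ‖φ₀ (θ x)‖ = |a⁻¹| * ‖φ₀ (a • θ x)‖ := by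
        rw [← Real.norm_eq_abs, ← norm_smul, ← map_smul, inv_smul_smul₀ ha.ne']
    _ ≤ K * ‖φ₀ (a • θ x)‖ := by gcongr

lemma exists_finite_hasEdgesIn {F : Set (Σ m : ℕ, PointedCone ℝ (Fin m → ℝ))} (hF : F.Finite)
    (d K : ℕ) :
    ∃ E : Set (Fin d → ℝ), E.Finite ∧ E ⊆ intLattice d ∧
      ∀ {n : ℕ} {P : Set (Fin n → ℝ)}, IsLatticePolytope P → (P ∩ intLattice n).encard ≤ K →
        polytopeDim P = d → NormalConesIn F P → ∀ u ∈ P.extremePoints ℝ, HasEdgesIn E P u := by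
  have hσ (σ : Σ m : ℕ, PointedCone ℝ (Fin m → ℝ)) : ∃ E : Set (Fin d → ℝ), E.Finite ∧
      E ⊆ intLattice d ∧ ∀ {n : ℕ} {P : Set (Fin n → ℝ)} {u : Fin n → ℝ}, IsLatticePolytope P →
        (P ∩ intLattice n).encard ≤ K → polytopeDim P = d → u ∈ P.extremePoints ℝ →
        ConesEquivalent (dualLattice P) (normalCone P u) (intLattice σ.1) σ.2 →
        HasEdgesIn E P u := by
    by_cases hex : ∃ (n₀ : ℕ) (P₀ : Set (Fin n₀ → ℝ)) (u₀ : Fin n₀ → ℝ), IsLatticePolytope P₀ ∧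
      polytopeDim P₀ = d ∧ u₀ ∈ P₀.extremePoints ℝ ∧
      ConesEquivalent (dualLattice P₀) (normalCone P₀ u₀) (intLattice σ.1) σ.2
    · obtain ⟨n₀, P₀, u₀, hP₀, hd, hu₀, h₀⟩ := hex
      obtain ⟨E, hE, hEL, h⟩ := exists_finite_hasEdgesIn_of_conesEquivalent hP₀ hd hu₀ K
      exact ⟨E, hE, hEL, fun hP hK _ hu hc => h hP hK hu (hc.trans h₀.symm)⟩
    · exact ⟨∅, Set.finite_empty, Set.empty_subset _,
        fun hP _ hd hu hc => (hex ⟨_, _, _, hP, hd, hu, hc⟩).elim⟩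
  choose E hE hEL h using hσ
  refine ⟨⋃ σ ∈ F, E σ, hF.biUnion fun σ _ => hE σ, Set.iUnion₂_subset fun σ _ => hEL σ,
    fun hP hK hd hPF u hu => ?_⟩
  obtain ⟨σ, hσF, hσ⟩ := hPF u hu
  exact (h σ hP hK hd hu hσ).mono (Set.subset_biUnion_of_mem hσF)

end EdgeVectors

section AffineImage

variable {V W : Type*} [AddCommGroup V] [Module ℝ V] [AddCommGroup W] [Module ℝ W]
  {f : V →ᵃ[ℝ] W}

lemma isExtreme_image_iff (hf : Function.Injective f) {A B : Set V} :
    IsExtreme ℝ (f '' A) (f '' B) ↔ IsExtreme ℝ A B := by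
  simp only [isExtreme_iff, Set.image_subset_image_iff hf, Set.forall_mem_image,
    ← image_openSegment, hf.mem_set_image]

lemma map_mem_extremePoints_image_iff (hf : Function.Injective f) {A : Set V} {x : V} :
    f x ∈ (f '' A).extremePoints ℝ ↔ x ∈ A.extremePoints ℝ := by
  rw [← isExtreme_singleton, ← Set.image_singleton, isExtreme_image_iff hf, isExtreme_singleton]

lemma isEdge_image_iff (hf : Function.Injective f) {A : Set V} {x y : V} :
    IsEdge (f '' A) (f x) (f y) ↔ IsEdge A x y := by
  rw [IsEdge, IsEdge, ← image_segment, isExtreme_image_iff hf, hf.ne_iff]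

lemma exists_affineMap_leftInverse (hf : Function.Injective f) :
    ∃ g : W →ᵃ[ℝ] V, Function.LeftInverse g f := by
  obtain ⟨g, hg⟩ := f.linear.exists_leftInverse_of_injective
    (LinearMap.ker_eq_bot.2 (f.linear_injective_iff.2 hf))
  refine ⟨g.toAffineMap - AffineMap.const ℝ W (g (f 0)), fun x => ?_⟩
  have hsub : f.linear x = f x - f 0 := by simpa using f.linearMap_vsub x 0
  change g (f x) - g (f 0) = x
  rw [← map_sub, ← hsub]
  exact LinearMap.congr_fun hg x

end AffineImage

section LatticeChart

variable {n d : ℕ} {P : Set (Fin n → ℝ)} {f : (Fin d → ℝ) →ᵃ[ℝ] (Fin n → ℝ)}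

/-- `f` is a system of affine coordinates on the affine span of `P` in which the integer points
become `ℤᵈ`. -/
structure IsLatticeChart (f : (Fin d → ℝ) →ᵃ[ℝ] (Fin n → ℝ)) (P : Set (Fin n → ℝ)) : Prop where
  injective : Function.Injective f
  range_eq : Set.range f = affineSpan ℝ P
  preimage_intLattice : f ⁻¹' intLattice n = intLattice d

lemma exists_isLatticeChart {u : Fin n → ℝ} (hu : u ∈ P ∩ intLattice n)
    {φ : dirSpace P ≃ₗ[ℝ] (Fin d → ℝ)}
    (hφ : ∀ x : dirSpace P, (x : Fin n → ℝ) ∈ intLattice n ↔ φ x ∈ intLattice d) :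
    ∃ f : (Fin d → ℝ) →ᵃ[ℝ] (Fin n → ℝ), IsLatticeChart f P ∧ ∀ y, f y = u + φ.symm y := by
  have huP : u ∈ affineSpan ℝ P := subset_affineSpan ℝ P hu.1
  refine ⟨AffineMap.const ℝ _ u + ((dirSpace P).subtype.comp φ.symm.toLinearMap).toAffineMap,
    ⟨fun x y h => φ.symm.injective (Subtype.ext (add_left_cancel h)), ?_, ?_⟩, fun _ => rfl⟩
  · ext p
    rw [SetLike.mem_coe, ← AffineSubspace.vsub_right_mem_direction_iff_mem huP]
    constructor
    · rintro ⟨y, rfl⟩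
      simp
    · exact fun hp => ⟨φ ⟨p - u, hp⟩, by simp⟩
  · ext y
    change u + (φ.symm y : Fin n → ℝ) ∈ intLattice n ↔ _
    rw [← φ.apply_symm_apply y, ← hφ, φ.apply_symm_apply]
    refine ⟨fun h => ?_, add_mem_intLattice hu.2⟩
    simpa using sub_mem_intLattice h hu.2

namespace IsLatticeChart

lemma image_preimage (hf : IsLatticeChart f P) : f '' (f ⁻¹' P) = P :=
  Set.image_preimage_eq_of_subset (hf.range_eq ▸ subset_affineSpan ℝ P)

lemma image_intLattice (hf : IsLatticeChart f P) :
    f '' intLattice d = intLattice n ∩ affineSpan ℝ P := by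
  rw [← hf.preimage_intLattice, Set.image_preimage_eq_inter_range, hf.range_eq]

lemma isLatticePolytope_preimage (hf : IsLatticeChart f P) (hP : IsLatticePolytope P) :
    IsLatticePolytope (f ⁻¹' P) := by
  obtain ⟨S, hS, hSL, rfl⟩ := hP
  refine ⟨f ⁻¹' S, hS.preimage hf.injective.injOn,
    hf.preimage_intLattice ▸ Set.preimage_mono hSL, hf.injective.image_injective ?_⟩
  have hSr : S ⊆ Set.range f :=
    hf.range_eq ▸ (subset_convexHull ℝ S).trans (subset_affineSpan ℝ _)
  rw [hf.image_preimage, f.image_convexHull, Set.image_preimage_eq_of_subset hSr]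

lemma encard_preimage (hf : IsLatticeChart f P) :
    (f ⁻¹' P ∩ intLattice d).encard = (P ∩ intLattice n).encard := by
  rw [← hf.preimage_intLattice, ← Set.preimage_inter, ← hf.injective.encard_image,
    Set.image_preimage_eq_of_subset]
  exact Set.inter_subset_left.trans (hf.range_eq ▸ subset_affineSpan ℝ P)

lemma vectorSpan_preimage (hf : IsLatticeChart f P) : vectorSpan ℝ (f ⁻¹' P) = ⊤ := by
  have hmap : affineSpan ℝ P = (⊤ : AffineSubspace ℝ (Fin d → ℝ)).map f :=
    SetLike.coe_injective (by simp [← hf.range_eq])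
  apply Submodule.map_injective_of_injective (f.linear_injective_iff.2 hf.injective)
  rw [f.map_vectorSpan, hf.image_preimage, ← direction_affineSpan, hmap,
    AffineSubspace.map_direction, AffineSubspace.direction_top]

lemma integrallyEquivalent {m : ℕ} {Q : Set (Fin m → ℝ)} {g : (Fin d → ℝ) →ᵃ[ℝ] (Fin m → ℝ)}
    (hf : IsLatticeChart f P) (hg : IsLatticeChart g Q) (h : f ⁻¹' P = g ⁻¹' Q) :
    IntegrallyEquivalent P Q := by
  obtain ⟨r, hr⟩ := exists_affineMap_leftInverse hf.injective
  have hgr : (g.comp r) ∘ f = g := funext fun y => congrArg g (hr y)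
  refine ⟨g.comp r, ?_, ?_⟩
  · have hinj : Set.InjOn (g.comp r) (f '' intLattice d) :=
      Set.InjOn.image_of_comp (hgr ▸ hg.injective.injOn)
    have hbij := hinj.bijOn_image
    rwa [← Set.image_comp, hgr, hf.image_intLattice, hg.image_intLattice] at hbij
  · rw [← hf.image_preimage, ← Set.image_comp, hgr, h, hg.image_preimage]

end IsLatticeChart

lemma exists_isLatticeChart_isFramed {K : ℕ} {E : Set (Fin d → ℝ)} (hP : IsLatticePolytope P)
    (hK : (P ∩ intLattice n).encard ≤ K) (hne : P.Nonempty)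
    (hE : ∀ u ∈ P.extremePoints ℝ, HasEdgesIn E P u) :
    ∃ f : (Fin d → ℝ) →ᵃ[ℝ] (Fin n → ℝ), IsLatticeChart f P ∧ IsFramed K E (f ⁻¹' P) := by
  obtain ⟨u, hu⟩ := hP.isPolytope.extremePoints_nonempty hne
  obtain ⟨φ, hφ, hφE⟩ := hE u hu
  obtain ⟨f, hf, hfφ⟩ := exists_isLatticeChart ⟨hu.1, hP.extremePoints_subset hu⟩ hφ
  have hext {y : Fin d → ℝ} : y ∈ (f ⁻¹' P).extremePoints ℝ ↔ f y ∈ P.extremePoints ℝ := by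
    rw [← map_mem_extremePoints_image_iff hf.injective, hf.image_preimage]
  have hedge {y z : Fin d → ℝ} : IsEdge (f ⁻¹' P) y z ↔ IsEdge P (f y) (f z) := by
    rw [← isEdge_image_iff hf.injective, hf.image_preimage]
  have hf0 : f 0 = u := by simp [hfφ]
  refine ⟨f, hf, hf.isLatticePolytope_preimage hP, hf.encard_preimage.trans_le hK,
    hf.vectorSpan_preimage, hext.2 (hf0 ▸ hu), fun w hw => ?_, fun y hy => ?_⟩
  · rw [hedge, hf0, hfφ] at hw
    simpa using hφE _ hw
  · obtain ⟨ψ, hψ, hψE⟩ := hE (f y) (hext.1 hy)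
    refine ⟨φ.symm ≪≫ₗ ψ, fun x hx => ?_, fun w hw => hψE (φ.symm (w - y)) ?_⟩
    · rwa [LinearEquiv.trans_apply, ← hψ, hφ, φ.apply_symm_apply]
    · have hfw : f w = f y + φ.symm (w - y) := by
        rw [hfφ, hfφ, map_sub, Submodule.coe_sub]
        abel
      rwa [hedge, hfw] at hw

end LatticeChart

section Counting

lemma finitelyManyUpToEquivalence_of_finite {κ : Type*} {C : Set (Σ n : ℕ, Set (Fin n → ℝ))}
    {R : (Σ n : ℕ, Set (Fin n → ℝ)) → κ → Prop} {T : Set κ} (hT : T.Finite)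
    (hC : ∀ P ∈ C, ∃ c ∈ T, R P c)
    (hR : ∀ P Q c, R P c → R Q c → IntegrallyEquivalent P.2 Q.2) :
    FinitelyManyUpToEquivalence C := by
  have hfin : {c ∈ T | ∃ P ∈ C, R P c}.Finite := hT.subset (Set.sep_subset _ _)
  choose! g hg using fun c (hc : c ∈ {c ∈ T | ∃ P ∈ C, R P c}) => hc.2
  refine ⟨g '' {c ∈ T | ∃ P ∈ C, R P c}, ?_, hfin.image g, fun P hP => ?_⟩
  · rintro _ ⟨c, hc, rfl⟩
    exact (hg c hc).1
  · obtain ⟨c, hcT, hc⟩ := hC P hP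
    have hcC : c ∈ {c ∈ T | ∃ P ∈ C, R P c} := ⟨hcT, P, hP, hc⟩
    exact ⟨g c, Set.mem_image_of_mem g hcC, hR P _ c hc (hg c hcC).2⟩

lemma coneDim_eq_polytopeDim {n m : ℕ} {P : Set (Fin n → ℝ)} (hP : IsPolytope P) {u : Fin n → ℝ}
    (hu : u ∈ P.extremePoints ℝ) {Λ : Set (Fin m → ℝ)} {σ : PointedCone ℝ (Fin m → ℝ)}
    (h : ConesEquivalent (dualLattice P) (normalCone P u) Λ σ) : coneDim σ = polytopeDim P := by
  obtain ⟨f, -⟩ := h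
  rw [coneDim, ← f.finrank_eq, hP.span_normalCone hu, finrank_top, Subspace.dual_finrank_eq,
    polytopeDim]

lemma nonempty_of_mem_polytopesWith {k : ℕ} (hk : k ≠ 0)
    {F : Set (Σ m : ℕ, PointedCone ℝ (Fin m → ℝ))} {P : Σ n : ℕ, Set (Fin n → ℝ)}
    (hP : P ∈ polytopesWith k F) : P.2.Nonempty := by
  have hne : (P.2 ∩ intLattice P.1).Nonempty := by
    rw [← Set.encard_ne_zero, hP.2.1]
    exact_mod_cast hk
  exact hne.mono Set.inter_subset_left

end Counting

end LatticePolytopes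

open LatticePolytopes in
theorem mainTheorem2_general (K : ℕ) {F : Set (Σ m : ℕ, PointedCone ℝ (Fin m → ℝ))}
    (hF : F.Finite) {C : Set (Σ n : ℕ, Set (Fin n → ℝ))}
    (hC : ∀ P ∈ C, P.2.Nonempty ∧ IsLatticePolytope P.2 ∧
      (P.2 ∩ intLattice P.1).encard ≤ K ∧ NormalConesIn F P.2) :
    FinitelyManyUpToEquivalence C := by
  choose E hE hEL hEF using fun d => exists_finite_hasEdgesIn hF d K
  refine finitelyManyUpToEquivalence_of_finite
    (R := fun P c => ∃ f : (Fin c.1 → ℝ) →ᵃ[ℝ] (Fin P.1 → ℝ),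
      IsLatticeChart f P.2 ∧ f ⁻¹' P.2 = c.2)
    (T := ⋃ d ∈ (fun σ : Σ m : ℕ, PointedCone ℝ (Fin m → ℝ) => coneDim σ.2) '' F,
      Sigma.mk d '' {Q | IsFramed K (E d) Q})
    ((hF.image _).biUnion fun d _ => (finite_isFramed (hE d) (hEL d) K).image _) ?_ ?_
  · intro P hPC
    obtain ⟨hne, hP, hcard, hPF⟩ := hC P hPC
    obtain ⟨f, hf, hframed⟩ := exists_isLatticeChart_isFramed hP hcard hne
      (hEF (polytopeDim P.2) hP hcard rfl hPF)
    obtain ⟨u, hu⟩ := hP.isPolytope.extremePoints_nonempty hne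
    obtain ⟨σ, hσF, hσ⟩ := hPF u hu
    exact ⟨⟨_, f ⁻¹' P.2⟩, Set.mem_biUnion ⟨σ, hσF, coneDim_eq_polytopeDim hP.isPolytope hu hσ⟩
      ⟨_, hframed, rfl⟩, f, hf, rfl⟩
  · rintro P Q c ⟨f, hf, hfc⟩ ⟨g, hg, hgc⟩
    exact hf.integrallyEquivalent hg (hfc.trans hgc.symm)

/-- First part: lattice `d`-polytopes and a finite family of rational `d`-cones, for a fixed `d`.
Second part: the same without fixing the dimension of the polytopes and of the cones. -/
theorem mainTheorem2 (N : ℕ) (F : Set (Σ m : ℕ, PointedCone ℝ (Fin m → ℝ))) (hfin : F.Finite)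
    (hrat : ∀ σ ∈ F, LatticePolytopes.IsRationalCone σ.2) :
    (∀ d : ℕ, (∀ σ ∈ F, LatticePolytopes.coneDim σ.2 = d) →
      LatticePolytopes.FinitelyManyUpToEquivalence
        {P ∈ LatticePolytopes.polytopesWith (N + 1) F | LatticePolytopes.polytopeDim P.2 = d}) ∧
    LatticePolytopes.FinitelyManyUpToEquivalence (LatticePolytopes.polytopesWith (N + 1) F) := by
  have finitelyMany {C : Set (Σ n : ℕ, Set (Fin n → ℝ))}
      (hC : C ⊆ LatticePolytopes.polytopesWith (N + 1) F) :
      LatticePolytopes.FinitelyManyUpToEquivalence C :=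
    mainTheorem2_general (N + 1) hfin fun P hP =>
      ⟨LatticePolytopes.nonempty_of_mem_polytopesWith N.succ_ne_zero (hC hP), (hC hP).1,
        (hC hP).2.1.le, (hC hP).2.2⟩
  exact ⟨fun _ _ => finitelyMany (Set.sep_subset _ _), finitelyMany subset_rfl⟩
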